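/- Let $\mathbb K\in\{\mathbb R,\mathbb C\}$. If $\mathbb K=\mathbb R$, let $r\in\{1,2,\ldots\}\cup\{\infty,\omega\}$ (ordered by $k<\infty<\omega$ for all $k\in\{1,2,\ldots\}$); if $\mathbb K=\mathbb C$, let $r=\omega$. Here $C^r_{\mathbb R}$ means $C^r$ in the sense of Bastiani for $r\in\mathbb N\cup\{\infty\}$ (all iterated directional derivatives up to order $r$ exist and are jointly continuous), $C^\omega_{\mathbb C}$ means complex analytic (continuous, and locally the pointwise limit of a series of continuous homogeneous polynomials), and $C^\omega_{\mathbb R}$ means real analytic (extends to a complex analytic map on an open neighbourhood of its domain in the complexification). All spaces are Hausdorff. Let $f\colon M\to N$ be a $C^r_{\mathbb K}$-map between $C^r_{\mathbb K}$-manifolds modelled on locally convex topological $\mathbb K$-vector spaces $E$ and $F$, respectively. A vector subspace $Y$ of a topological vector space $Z$ is called complemented if there is a vector subspace $C\subseteq Z$ such that the addition map $Y\times C\to Z$ is an isomorphism of topological vector spaces. The map $f$ is called a $C^r_{\mathbb K}$-immersion if, for each $x\in M$, there exist charts $\phi\colon U_\phi\to V_\phi\subseteq E$ of $M$ with $x\in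 U_\phi$ and $\psi\colon U_\psi\to V_\psi\subseteq F$ of $N$ with $f(x)\in U_\psi$ such that $f(U_\phi)\subseteq U_\psi$ and $\psi\circ f\circ\phi^{-1}=j|_{V_\phi}$ for a linear map $j\colon E\to F$ which is a topological embedding onto a complemented vector subspace of $F$. The map $f$ is called a naive immersion if, for each $x\in M$, the tangent map $T_xf\colon T_xM\to T_{f(x)}N$ is a topological embedding whose image is a complemented vector subspace of $T_{f(x)}N$. Theorem. Assume that (a) $M$ is a Banach manifold (i.e., $E$ is a Banach space) and $r\ge 2$; or (b) $M$ is finite-dimensional (i.e., $E$ is finite-dimensional). Then $f$ is a $C^r_{\mathbb K}$-immersion if and only if $f$ is a naive immersion. -/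

import Mathlib

open Set Filter Topology
open scoped ContDiff

universe u v

namespace LCCalculus

/-! ### Differential calculus on locally convex spaces -/

section Calculus

/-- `w` is the directional derivative `df(x, y) = d/dt|_{t=0} f(x + t y)`. -/
def HasDirDerivAt (𝕜 : Type*) [RCLike 𝕜] {E F : Type*}
    [AddCommGroup E] [Module 𝕜 E] [AddCommGroup F] [Module 𝕜 F] [TopologicalSpace F]
    (f : E → F) (x y : E) (w : F) : Prop :=
  Tendsto (fun t : 𝕜 => t⁻¹ • (f (x + t • y) - f x)) (𝓝[≠] 0) (𝓝 w)

/-- The continuous linear map `L` is the differential `f'(x) = df(x, ·)`. -/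
def HasDifferentialAt (𝕜 : Type*) [RCLike 𝕜] {E F : Type*}
    [AddCommGroup E] [Module 𝕜 E] [TopologicalSpace E]
    [AddCommGroup F] [Module 𝕜 F] [TopologicalSpace F]
    (f : E → F) (x : E) (L : E →L[𝕜] F) : Prop :=
  ∀ y : E, HasDirDerivAt 𝕜 f x y (L y)

/-- `f` is `C^k` (`k` finite) on the open set `U`: it is continuous if `k = 0`, and for `k = n + 1`
it is continuous, has directional derivatives `df(x, y)` at all `x ∈ U` in all directions `y`, and
the map `df` is `C^n` on the open subset `U × E` of `E × E`. -/
def CkOn (𝕜 : Type*) [RCLike 𝕜] {F : Type v} [AddCommGroup F] [Module 𝕜 F] [TopologicalSpace F] :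
    ℕ → ∀ {E : Type u} [AddCommGroup E] [Module 𝕜 E] [TopologicalSpace E],
      (E → F) → Set E → Prop
  | 0, _, _, _, _, f, U => ContinuousOn f U
  | n + 1, E, _, _, _, f, U => ContinuousOn f U ∧ ∃ df : E × E → F,
      (∀ x ∈ U, ∀ y : E, HasDirDerivAt 𝕜 f x y (df (x, y))) ∧ CkOn 𝕜 n df (U ×ˢ univ)

/-- `f` is continuous on the open set `U` and, near each `x ∈ U`, it is the pointwise limit of a
series of continuous homogeneous polynomials `y ↦ p n (y, …, y)`. For `𝕜 = ℂ`, these are the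
complex analytic maps. -/
def SeriesAnalyticOn (𝕜 : Type*) [RCLike 𝕜] {E F : Type*}
    [AddCommGroup E] [Module 𝕜 E] [TopologicalSpace E]
    [AddCommGroup F] [Module 𝕜 F] [TopologicalSpace F] (f : E → F) (U : Set E) : Prop :=
  ContinuousOn f U ∧ ∀ x ∈ U,
    ∃ p : (n : ℕ) → ContinuousMultilinearMap 𝕜 (fun _ : Fin n => E) F,
      ∀ᶠ y in 𝓝 (0 : E), HasSum (fun n => p n (fun _ => y)) (f (x + y))

/-- The complexification `E_ℂ = E ⊕ iE` of a vector space over `𝕜` (used for `𝕜 = ℝ`), with the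
product topology. -/
def Complexification (_𝕜 : Type*) (E : Type*) : Type _ := E × E

instance (𝕜 E : Type*) [AddCommGroup E] : AddCommGroup (Complexification 𝕜 E) :=
  inferInstanceAs (AddCommGroup (E × E))

instance (𝕜 E : Type*) [TopologicalSpace E] : TopologicalSpace (Complexification 𝕜 E) :=
  inferInstanceAs (TopologicalSpace (E × E))

/-- `(a + ib)(x + iy) = (ax - by) + i(ay + bx)`. -/
noncomputable instance (𝕜 E : Type*) [RCLike 𝕜] [AddCommGroup E] [Module 𝕜 E] :
    Module ℂ (Complexification 𝕜 E) where
  smul z p := ((z.re : 𝕜) • p.1 - (z.im : 𝕜) • p.2, (z.re : 𝕜) • p.2 + (z.im : 𝕜) • p.1)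
  one_smul p := by
    refine Prod.ext ?_ ?_
    · change ((1 : ℂ).re : 𝕜) • p.1 - ((1 : ℂ).im : 𝕜) • p.2 = p.1
      simp
    · change ((1 : ℂ).re : 𝕜) • p.2 + ((1 : ℂ).im : 𝕜) • p.1 = p.2
      simp
  mul_smul z w p := by
    refine Prod.ext ?_ ?_
    · change ((z * w).re : 𝕜) • p.1 - ((z * w).im : 𝕜) • p.2 =
        (z.re : 𝕜) • ((w.re : 𝕜) • p.1 - (w.im : 𝕜) • p.2)
          - (z.im : 𝕜) • ((w.re : 𝕜) • p.2 + (w.im : 𝕜) • p.1)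
      simp only [Complex.mul_re, Complex.mul_im]
      push_cast
      module
    · change ((z * w).re : 𝕜) • p.2 + ((z * w).im : 𝕜) • p.1 =
        (z.re : 𝕜) • ((w.re : 𝕜) • p.2 + (w.im : 𝕜) • p.1)
          + (z.im : 𝕜) • ((w.re : 𝕜) • p.1 - (w.im : 𝕜) • p.2)
      simp only [Complex.mul_re, Complex.mul_im]
      push_cast
      module
  smul_zero z := by
    refine Prod.ext ?_ ?_
    · change (z.re : 𝕜) • (0 : E) - (z.im : 𝕜) • (0 : E) = 0
      simp
    · change (z.re : 𝕜) • (0 : E) + (z.im : 𝕜) • (0 : E) = 0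
      simp
  smul_add z p q := by
    refine Prod.ext ?_ ?_
    · change (z.re : 𝕜) • (p.1 + q.1) - (z.im : 𝕜) • (p.2 + q.2) =
        ((z.re : 𝕜) • p.1 - (z.im : 𝕜) • p.2) + ((z.re : 𝕜) • q.1 - (z.im : 𝕜) • q.2)
      module
    · change (z.re : 𝕜) • (p.2 + q.2) + (z.im : 𝕜) • (p.1 + q.1) =
        ((z.re : 𝕜) • p.2 + (z.im : 𝕜) • p.1) + ((z.re : 𝕜) • q.2 + (z.im : 𝕜) • q.1)
      module
  add_smul z w p := by
    refine Prod.ext ?_ ?_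
    · change ((z + w).re : 𝕜) • p.1 - ((z + w).im : 𝕜) • p.2 =
        ((z.re : 𝕜) • p.1 - (z.im : 𝕜) • p.2) + ((w.re : 𝕜) • p.1 - (w.im : 𝕜) • p.2)
      simp only [Complex.add_re, Complex.add_im]
      push_cast
      module
    · change ((z + w).re : 𝕜) • p.2 + ((z + w).im : 𝕜) • p.1 =
        ((z.re : 𝕜) • p.2 + (z.im : 𝕜) • p.1) + ((w.re : 𝕜) • p.2 + (w.im : 𝕜) • p.1)
      simp only [Complex.add_re, Complex.add_im]
      push_cast
      module
  zero_smul p := by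
    refine Prod.ext ?_ ?_
    · change ((0 : ℂ).re : 𝕜) • p.1 - ((0 : ℂ).im : 𝕜) • p.2 = 0
      simp
    · change ((0 : ℂ).re : 𝕜) • p.2 + ((0 : ℂ).im : 𝕜) • p.1 = 0
      simp

/-- The embedding `E → E_ℂ`, `x ↦ x + i0`. -/
def toComplexification (𝕜 : Type*) {E : Type*} [AddCommGroup E] (x : E) : Complexification 𝕜 E :=
  (x, 0)

/-- `f` is real analytic on the open set `U ⊆ E`: it extends to a complex analytic map into `F_ℂ`
on an open neighbourhood of `U` in `E_ℂ` (used for `𝕜 = ℝ`). -/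
def RealAnalyticOn (𝕜 : Type*) [RCLike 𝕜] {E F : Type*}
    [AddCommGroup E] [Module 𝕜 E] [TopologicalSpace E]
    [AddCommGroup F] [Module 𝕜 F] [TopologicalSpace F] (f : E → F) (U : Set E) : Prop :=
  ∃ (V : Set (Complexification 𝕜 E)) (g : Complexification 𝕜 E → Complexification 𝕜 F),
    IsOpen V ∧ (∀ x ∈ U, toComplexification 𝕜 x ∈ V) ∧ SeriesAnalyticOn ℂ g V ∧
      ∀ x ∈ U, g (toComplexification 𝕜 x) = toComplexification 𝕜 (f x)

/-- `f` is `C^r_𝕜` on the open set `U`: for `r = ω`, real analytic if `𝕜 = ℝ` and complex analytic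
if `𝕜 = ℂ`; for `r ∈ ℕ ∪ {∞}`, it is `C^n` for all natural numbers `n ≤ r`.
(`RCLike.I = 0` distinguishes `ℝ` from `ℂ`.) -/
def CrOn (𝕜 : Type*) [RCLike 𝕜] (r : WithTop ℕ∞) {E : Type u} {F : Type v}
    [AddCommGroup E] [Module 𝕜 E] [TopologicalSpace E]
    [AddCommGroup F] [Module 𝕜 F] [TopologicalSpace F] (f : E → F) (U : Set E) : Prop :=
  (r = ω → (RCLike.I : 𝕜) = 0 → RealAnalyticOn 𝕜 f U) ∧
  (r = ω → (RCLike.I : 𝕜) ≠ 0 → SeriesAnalyticOn 𝕜 f U) ∧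
  (r ≠ ω → ∀ n : ℕ, (n : WithTop ℕ∞) ≤ r → CkOn 𝕜 n f U)

end Calculus

/-! ### Manifolds and tangent maps

Manifolds are given by an atlas (`ChartedSpace E M`); all notions refer to the charts of the
maximal atlas determined by it. -/

section Manifolds

variable (𝕜 : Type*) [RCLike 𝕜] (r : WithTop ℕ∞)
  {E : Type*} [AddCommGroup E] [Module 𝕜 E] [TopologicalSpace E]
  {F : Type*} [AddCommGroup F] [Module 𝕜 F] [TopologicalSpace F]
  {M : Type*} [TopologicalSpace M] [ChartedSpace E M]
  {N : Type*} [TopologicalSpace N] [ChartedSpace F N]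

/-- `φ` is a chart of the maximal `C^r_𝕜`-atlas: its coordinate changes with all charts of the
given atlas are `C^r_𝕜`. -/
def IsChart (φ : OpenPartialHomeomorph M E) : Prop :=
  ∀ e ∈ atlas E M,
    CrOn 𝕜 r (fun u => e (φ.symm u)) (φ.symm.trans e).source ∧
    CrOn 𝕜 r (fun u => φ (e.symm u)) (e.symm.trans φ).source

variable (E M) in
/-- `M` is a `C^r_𝕜`-manifold modelled on `E`: the coordinate changes of its atlas are `C^r_𝕜`. -/
def IsCrManifold : Prop := ∀ e ∈ atlas E M, IsChart 𝕜 r e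

/-- `f : M → N` is a `C^r_𝕜`-map. -/
def IsCrMap (f : M → N) : Prop :=
  Continuous f ∧ ∀ (φ : OpenPartialHomeomorph M E) (ψ : OpenPartialHomeomorph N F),
    IsChart 𝕜 r φ → IsChart 𝕜 r ψ →
      CrOn 𝕜 r (fun u => ψ (f (φ.symm u))) (φ.target ∩ φ.symm ⁻¹' (f ⁻¹' ψ.source))

variable (E) in
/-- The charts of `M` around `x`. -/
abbrev ChartsAt (x : M) : Type _ :=
  {φ : OpenPartialHomeomorph M E // IsChart 𝕜 r φ ∧ x ∈ φ.source}

variable (E) in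
/-- The tangent space `T_x M`: a tangent vector is a family `(v_φ)` of vectors of `E`, one for each
chart `φ` around `x`, such that `v_ψ = (ψ ∘ φ⁻¹)'(φ(x)) v_φ` for all such charts `φ` and `ψ`.
Its topology is the one that it inherits from the product topology; every component map
`v ↦ v_φ` is an isomorphism of topological vector spaces onto `E`, since the transition
differentials are such isomorphisms if `M` is a `C^r_𝕜`-manifold with `r ≥ 1`. -/
def tangentSpace (x : M) : Submodule 𝕜 (ChartsAt 𝕜 r E x → E) where
  carrier := {v | ∀ (φ ψ : ChartsAt 𝕜 r E x) (L : E →L[𝕜] E),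
    HasDifferentialAt 𝕜 (fun u => ψ.1 (φ.1.symm u)) (φ.1 x) L → v ψ = L (v φ)}
  add_mem' {v w} hv hw φ ψ L hL := by
    simp only [Pi.add_apply, map_add, hv φ ψ L hL, hw φ ψ L hL]
  zero_mem' φ ψ L _ := by simp
  smul_mem' c v hv φ ψ L hL := by
    simp only [Pi.smul_apply, map_smul, hv φ ψ L hL]

/-- The continuous linear map `T` is the tangent map `T_x f : T_x M → T_{f(x)} N`: in all charts
`φ` around `x` and `ψ` around `f(x)`, it is given by `v ↦ d(ψ ∘ f ∘ φ⁻¹)(φ(x), v)`. -/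
def IsTangentMap (f : M → N) (x : M)
    (T : tangentSpace 𝕜 r E x →L[𝕜] tangentSpace 𝕜 r F (f x)) : Prop :=
  ∀ (φ : ChartsAt 𝕜 r E x) (ψ : ChartsAt 𝕜 r F (f x)) (v : tangentSpace 𝕜 r E x),
    HasDirDerivAt 𝕜 (fun u => ψ.1 (f (φ.1.symm u))) (φ.1 x) (v.1 φ) ((T v).1 ψ)

/-- `f` is a `C^r_𝕜`-immersion: in suitable charts around `x` and `f(x)`, it is the restriction of
a linear map which is a topological embedding onto a complemented vector subspace. -/
def IsCrImmersion (f : M → N) : Prop :=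
  ∀ x : M, ∃ (φ : OpenPartialHomeomorph M E) (ψ : OpenPartialHomeomorph N F) (j : E →ₗ[𝕜] F),
    IsChart 𝕜 r φ ∧ IsChart 𝕜 r ψ ∧ x ∈ φ.source ∧ f x ∈ ψ.source ∧
    MapsTo f φ.source ψ.source ∧
    IsEmbedding j ∧ (LinearMap.range j).ClosedComplemented ∧
    ∀ u ∈ φ.target, ψ (f (φ.symm u)) = j u

/-- `f` is a naive immersion: each tangent map `T_x f` is a topological embedding whose image is
a complemented vector subspace of `T_{f(x)} N`. -/
def IsNaiveImmersion (f : M → N) : Prop :=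
  ∀ x : M, ∃ T : tangentSpace 𝕜 r E x →L[𝕜] tangentSpace 𝕜 r F (f x),
    IsTangentMap 𝕜 r f x T ∧ IsEmbedding T ∧
    (LinearMap.range (T : tangentSpace 𝕜 r E x →ₗ[𝕜] tangentSpace 𝕜 r F (f x))).ClosedComplemented

end Manifolds

/-- The topological vector space `E` is a Banach space, i.e. its topology can be given by a
complete norm. -/
def IsBanach (𝕜 : Type*) [RCLike 𝕜] (E : Type u) [AddCommGroup E] [Module 𝕜 E]
    [TopologicalSpace E] : Prop :=
  ∃ (B : Type u) (_ : NormedAddCommGroup B) (_ : NormedSpace 𝕜 B),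
    CompleteSpace B ∧ Nonempty (E ≃L[𝕜] B)

end LCCalculus

-- Let `j` be the tangent map of `f` at `x`, read in charts. A topological embedding onto a
-- complemented subspace is the same as a continuous linear map with a continuous linear left
-- inverse `P`. If `f` is linear in suitable charts, its tangent map is conjugate to that linear map
-- and inherits a left inverse; this is the easy direction.
--
-- Conversely, let `fl` be `f` in charts. The map `P ∘ fl` goes from an open set of `E` to `E` and
-- has differential `P ∘ j = id` at the base point, so the inverse function theorem is needed only
-- in the Banach space `E`, never in `F`. It yields a local diffeomorphism `Φ = P ∘ fl`. With `g =
-- fl ∘ Φ⁻¹` one has `P ∘ g = id`, so `j - g` takes values in `ker P`, and the shear `y ↦ y + (j -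
-- g)(P y)` is invertible by changing the sign. It sends `g u` to `j u`. Composing the two charts
-- with `Φ` and the shear makes `f` equal to `j`.
--
-- The bulk of the work is the inverse function theorem for `CrOn`. A Bastiani `C^2`-map between
-- normed spaces is Fréchet `C^1` (`CkOn.continuousOn_differential`), which is where `r ≥ 2` enters;
-- in finite dimensions `C^1` suffices. The classical theorem then gives a local inverse
-- (`exists_localInverse`), and its regularity follows by bootstrapping the formula for its
-- derivative (`CkOn.symm_apply`, `CkOn.localInverse`).
--
-- For analytic maps the bridge is that complex analytic means `C^n` over `ℂ` for all `n`
-- (`SeriesAnalyticOn.ckOn`, `seriesAnalyticOn_of_ckOn`), by Cauchy estimates and Taylor expansion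
-- on complex lines. In the real analytic case the complex extension is inverted on the
-- complexification and restricted back (`CrOn.exists_localInverse_banach`).

universe w

namespace LCCalculus

/-! ### Testing limits by maps into Banach spaces -/

section Seminorms

variable {𝕜 : Type*} [RCLike 𝕜]

/-- The local Banach space of a seminorm. -/
theorem exists_banach_norm_eq {F : Type v} [AddCommGroup F] [Module 𝕜 F] (p : Seminorm 𝕜 F) :
    ∃ (B : Type v) (_ : NormedAddCommGroup B) (_ : NormedSpace 𝕜 B) (_ : CompleteSpace B)
      (L : F →ₗ[𝕜] B), ∀ x, ‖L x‖ = p x := by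
  let _ : SeminormedAddCommGroup F := p.toAddGroupSeminorm.toSeminormedAddCommGroup
  let _ : NormedSpace 𝕜 F := { norm_smul_le := fun c x => (map_smul_eq_mul p c x).le }
  exact ⟨UniformSpace.Completion F, inferInstance, inferInstance, inferInstance,
    (UniformSpace.Completion.toComplₗᵢ (𝕜 := 𝕜) (E := F)).toLinearMap,
    fun x => (UniformSpace.Completion.toComplₗᵢ (𝕜 := 𝕜) (E := F)).norm_map x⟩

variable {F : Type v} [AddCommGroup F] [Module 𝕜 F] [TopologicalSpace F] [IsTopologicalAddGroup F]
  [PolynormableSpace 𝕜 F]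

/-- The topology is generated by continuous seminorms, and each of them is the norm pulled back
along the map to its local Banach space. Vector-valued limits thus reduce to the Banach case, with
no completeness assumed of `F`. -/
theorem tendsto_of_forall_clm {ι : Type*} {l : Filter ι} {f : ι → F} {a : F}
    (h : ∀ (B : Type v) [NormedAddCommGroup B] [NormedSpace 𝕜 B] [CompleteSpace B]
      (L : F →L[𝕜] B), Tendsto (fun i => L (f i)) l (𝓝 (L a))) : Tendsto f l (𝓝 a) := by
  rw [(PolynormableSpace.withSeminorms 𝕜 F).tendsto_nhds]
  rintro ⟨p, hp⟩ ε hε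
  obtain ⟨B, _, _, _, L, hL⟩ := exists_banach_norm_eq p
  have hLc : Continuous L := by
    refine continuous_of_tendsto_nhds_zero L ?_
    rw [tendsto_zero_iff_norm_tendsto_zero]
    simpa [hL] using hp.tendsto 0
  have := h B ⟨L, hLc⟩
  rw [tendsto_iff_norm_sub_tendsto_zero] at this
  filter_upwards [this.eventually (gt_mem_nhds hε)] with i hi
  simpa [← hL] using hi

end Seminorms

theorem tendsto_nhdsNE_zero_of_continuous {K K' : Type*} [RCLike K] [RCLike K'] {τ : K →+* K'}
    (hτ : Continuous τ) : Tendsto τ (𝓝[≠] 0) (𝓝[≠] 0) := by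
  refine tendsto_nhdsWithin_iff.2 ⟨?_, ?_⟩
  · exact (hτ.tendsto' _ _ (map_zero τ)).mono_left nhdsWithin_le_nhds
  · filter_upwards [self_mem_nhdsWithin] with t ht
    simpa using ht

theorem tendsto_ofReal_nhdsNE_zero {𝕜 : Type*} [RCLike 𝕜] :
    Tendsto (fun t : ℝ => (t : 𝕜)) (𝓝[≠] 0) (𝓝[≠] 0) :=
  tendsto_nhdsNE_zero_of_continuous (τ := algebraMap ℝ 𝕜) RCLike.continuous_ofReal

/-! ### Directional derivatives and the mean value inequality -/

section DirDeriv

variable {𝕜 : Type*} [RCLike 𝕜]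
  {E : Type u} [AddCommGroup E] [Module 𝕜 E]
  {F : Type v} [AddCommGroup F] [Module 𝕜 F] [TopologicalSpace F]

theorem HasDirDerivAt.unique [T2Space F] {f : E → F} {x y : E} {w w' : F}
    (h : HasDirDerivAt 𝕜 f x y w) (h' : HasDirDerivAt 𝕜 f x y w') : w = w' :=
  tendsto_nhds_unique h h'

theorem HasDirDerivAt.smul [ContinuousConstSMul 𝕜 F] {f : E → F} {x y : E} {w : F}
    (h : HasDirDerivAt 𝕜 f x y w) (c : 𝕜) : HasDirDerivAt 𝕜 f x (c • y) (c • w) := by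
  rcases eq_or_ne c 0 with rfl | hc
  · simpa [HasDirDerivAt] using tendsto_const_nhds
  have h1 : Tendsto (fun t : 𝕜 => t * c) (𝓝[≠] 0) (𝓝[≠] 0) := by
    refine tendsto_nhdsWithin_iff.2 ⟨?_, ?_⟩
    · exact (Continuous.tendsto' (by fun_prop) _ _ (by simp)).mono_left nhdsWithin_le_nhds
    · filter_upwards [self_mem_nhdsWithin] with t ht
      exact mul_ne_zero ht hc
  refine ((h.comp h1).const_smul c).congr' ?_
  filter_upwards [self_mem_nhdsWithin] with t ht
  have ht : t ≠ 0 := ht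
  simp only [Function.comp_apply, smul_smul]
  congr 1
  field_simp

theorem HasDirDerivAt.clm_comp {G : Type*} [AddCommGroup G] [Module 𝕜 G] [TopologicalSpace G]
    {f : E → F} {x y : E} {w : F} (h : HasDirDerivAt 𝕜 f x y w) (L : F →L[𝕜] G) :
    HasDirDerivAt 𝕜 (fun z => L (f z)) x y (L w) := by
  simpa [HasDirDerivAt, Function.comp_def] using (L.continuous.tendsto w).comp h

theorem HasDirDerivAt.add [ContinuousAdd F] {f g : E → F} {x y : E} {w w' : F}
    (h : HasDirDerivAt 𝕜 f x y w) (h' : HasDirDerivAt 𝕜 g x y w') :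
    HasDirDerivAt 𝕜 (fun z => f z + g z) x y (w + w') :=
  (Tendsto.add h h').congr fun t => by module

theorem HasDirDerivAt.prodMk {G : Type*} [AddCommGroup G] [Module 𝕜 G] [TopologicalSpace G]
    {f : E → F} {g : E → G} {x y : E} {w : F} {w' : G}
    (h : HasDirDerivAt 𝕜 f x y w) (h' : HasDirDerivAt 𝕜 g x y w') :
    HasDirDerivAt 𝕜 (fun z => (f z, g z)) x y (w, w') :=
  Tendsto.prodMk_nhds h h'

variable [TopologicalSpace E] [IsTopologicalAddGroup E] [ContinuousSMul 𝕜 E]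

theorem tendsto_add_smul (x y : E) : Tendsto (fun t : 𝕜 => x + t • y) (𝓝 0) (𝓝 x) :=
  Continuous.tendsto' (by fun_prop) _ _ (by simp)

theorem HasDirDerivAt.congr {f g : E → F} {x y : E} {w : F}
    (h : HasDirDerivAt 𝕜 f x y w) (hfg : f =ᶠ[𝓝 x] g) : HasDirDerivAt 𝕜 g x y w := by
  refine Tendsto.congr' ?_ h
  filter_upwards [((tendsto_add_smul x y).mono_left nhdsWithin_le_nhds).eventually hfg] with t ht
  rw [ht, hfg.eq_of_nhds]

end DirDeriv

section MeanValue

variable {𝕜 : Type*} [RCLike 𝕜] {E : Type u} [AddCommGroup E] [Module 𝕜 E]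

theorem HasDirDerivAt.hasDerivAt_real {B : Type*} [NormedAddCommGroup B] [NormedSpace 𝕜 B]
    [NormedSpace ℝ B] [IsScalarTower ℝ 𝕜 B] {g : E → B} {x v : E} {w : B} {s : ℝ}
    (h : HasDirDerivAt 𝕜 g (x + (s : 𝕜) • v) v w) :
    HasDerivAt (fun s : ℝ => g (x + (s : 𝕜) • v)) w s := by
  rw [hasDerivAt_iff_tendsto_slope_zero]
  refine (h.comp tendsto_ofReal_nhdsNE_zero).congr fun t => ?_
  simp only [Function.comp_apply]
  rw [← RCLike.ofReal_inv, RCLike.real_smul_eq_coe_smul (K := 𝕜) t⁻¹, RCLike.ofReal_add, add_smul,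
    add_assoc]

/-- Mean value inequality for directional derivatives. -/
theorem norm_sub_sub_le_of_hasDirDerivAt {B : Type*} [NormedAddCommGroup B] [NormedSpace 𝕜 B]
    {g : E → B} {dg : E × E → B} {x v : E} {w : B} {ε : ℝ}
    (hd : ∀ s ∈ Icc (0 : ℝ) 1,
      HasDirDerivAt 𝕜 g (x + (s : 𝕜) • v) v (dg (x + (s : 𝕜) • v, v)))
    (hb : ∀ s ∈ Icc (0 : ℝ) 1, ‖dg (x + (s : 𝕜) • v, v) - w‖ ≤ ε) :
    ‖g (x + v) - g x - w‖ ≤ ε := by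
  let _ : NormedSpace ℝ B := NormedSpace.restrictScalars ℝ 𝕜 B
  have : IsScalarTower ℝ 𝕜 B := ⟨fun a b c => by
    rw [RCLike.real_smul_eq_coe_mul, mul_smul]; rfl⟩
  have := norm_image_sub_le_of_norm_deriv_le_segment_01'
    (f := fun s : ℝ => g (x + (s : 𝕜) • v) - s • w)
    (f' := fun s => dg (x + (s : 𝕜) • v, v) - w) (C := ε)
    (fun s hs => ((hd s hs).hasDerivAt_real.sub
      (by simpa using (hasDerivAt_id s).smul_const w)).hasDerivWithinAt)
    (fun s hs => hb s (Ico_subset_Icc_self hs))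
  simpa [sub_right_comm] using this

variable [TopologicalSpace E] [IsTopologicalAddGroup E] [ContinuousSMul 𝕜 E]
  {F : Type v} [AddCommGroup F] [Module 𝕜 F] [TopologicalSpace F] [IsTopologicalAddGroup F]
  [ContinuousSMul 𝕜 F] [PolynormableSpace 𝕜 F]

/-- Difference quotients of a `C^1`-map converge jointly in the base point and the direction. -/
theorem tendsto_diffQuot {g : E → F} {dg : E × E → F} {U : Set E} (hU : IsOpen U)
    (hd : ∀ x ∈ U, ∀ y, HasDirDerivAt 𝕜 g x y (dg (x, y)))
    (hc : ContinuousOn dg (U ×ˢ univ)) {ι : Type*} {l : Filter ι} {t : ι → 𝕜} {z w : ι → E}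
    {z₀ w₀ : E} (ht : Tendsto t l (𝓝[≠] 0)) (hz : Tendsto z l (𝓝 z₀)) (hw : Tendsto w l (𝓝 w₀))
    (hz₀ : z₀ ∈ U) :
    Tendsto (fun i => (t i)⁻¹ • (g (z i + t i • w i) - g (z i))) l (𝓝 (dg (z₀, w₀))) := by
  refine tendsto_of_forall_clm (𝕜 := 𝕜) fun B _ _ _ L => ?_
  rw [tendsto_nhdsWithin_iff] at ht
  rw [Metric.tendsto_nhds]
  intro ε hε
  have hcont : ContinuousAt dg (z₀, w₀) :=
    hc.continuousAt ((hU.prod isOpen_univ).mem_nhds ⟨hz₀, mem_univ _⟩)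
  have hN : ∀ᶠ q : E × E in 𝓝 (z₀, w₀), dist (L (dg q)) (L (dg (z₀, w₀))) < ε / 2 ∧ q.1 ∈ U :=
    (((L.continuous.continuousAt.comp hcont).tendsto.eventually
      (Metric.ball_mem_nhds _ (half_pos hε)))).and
      (continuous_fst.continuousAt.preimage_mem_nhds (hU.mem_nhds hz₀))
  -- Compactness of `[0, 1]` makes the estimate uniform along the whole segment from `z i` to `z i +
  -- t i • w i`.
  have key : ∀ᶠ q : E × E × E in 𝓝 (z₀, 0, w₀), ∀ s ∈ Icc (0 : ℝ) 1,
      dist (L (dg (q.1 + (s : 𝕜) • q.2.1, q.2.2))) (L (dg (z₀, w₀))) < ε / 2 ∧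
        q.1 + (s : 𝕜) • q.2.1 ∈ U := by
    refine isCompact_Icc.eventually_forall_of_forall_eventually fun s _ => ?_
    have : Tendsto (fun q : (E × E × E) × ℝ => (q.1.1 + (q.2 : 𝕜) • q.1.2.1, q.1.2.2))
        (𝓝 ((z₀, 0, w₀), s)) (𝓝 (z₀, w₀)) :=
      Continuous.tendsto' (by fun_prop) _ _ (by simp)
    exact this.eventually hN
  have hq : Tendsto (fun i => (z i, t i • w i, w i)) l (𝓝 (z₀, 0, w₀)) := by
    refine hz.prodMk_nhds (Tendsto.prodMk_nhds ?_ hw)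
    simpa using ht.1.smul hw
  filter_upwards [hq.eventually key, ht.2] with i hi hti
  have hti : t i ≠ 0 := hti
  -- By homogeneity the derivative in the direction `t i • w i` carries a factor `t i`. The bound
  -- therefore contains `‖t i‖`, which cancels on forming the difference quotient.
  have := norm_sub_sub_le_of_hasDirDerivAt (g := fun x => L (g x)) (x := z i) (v := t i • w i)
    (dg := fun q => t i • L (dg (q.1, w i)))
    (w := t i • L (dg (z₀, w₀))) (ε := ‖t i‖ * (ε / 2)) (𝕜 := 𝕜)
    (fun s hs => by simpa using (((hd _ (hi s hs).2 (w i)).smul (t i)).clm_comp L))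
    (fun s hs => by
      rw [← smul_sub, norm_smul]
      gcongr
      rw [← dist_eq_norm]
      exact (hi s hs).1.le)
  have h2 : dist (L ((t i)⁻¹ • (g (z i + t i • w i) - g (z i)))) (L (dg (z₀, w₀))) ≤ ε / 2 := by
    rw [dist_eq_norm]
    have e : L ((t i)⁻¹ • (g (z i + t i • w i) - g (z i))) - L (dg (z₀, w₀)) =
        (t i)⁻¹ • (L (g (z i + t i • w i)) - L (g (z i)) - t i • L (dg (z₀, w₀))) := by
      rw [smul_sub (t i)⁻¹ (L _ - L _), inv_smul_smul₀ hti, map_smul, map_sub]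
    rw [e, norm_smul, norm_inv, inv_mul_le_iff₀ (norm_pos_iff.2 hti)]
    exact this
  linarith

end MeanValue

/-! ### Chain rule and linearity of the differential -/

section Differential

variable {𝕜 : Type*} [RCLike 𝕜]
  {E : Type u} [AddCommGroup E] [Module 𝕜 E] [TopologicalSpace E] [IsTopologicalAddGroup E]
  [ContinuousSMul 𝕜 E]
  {F : Type v} [AddCommGroup F] [Module 𝕜 F] [TopologicalSpace F] [IsTopologicalAddGroup F]
  [ContinuousSMul 𝕜 F] [PolynormableSpace 𝕜 F]

/-- One has `f (x + t y) = f x + t w_t`, where `w_t` is the difference quotient of `f` and tends to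
`w`. Since `tendsto_diffQuot` allows moving directions, one directional derivative of `f` is enough,
and `D` needs no topology. -/
theorem HasDirDerivAt.comp {D : Type*} [AddCommGroup D] [Module 𝕜 D] {f : D → E} {x y : D} {w : E}
    (hf : HasDirDerivAt 𝕜 f x y w) {g : E → F} {dg : E × E → F} {V : Set E} (hV : IsOpen V)
    (hd : ∀ x ∈ V, ∀ y, HasDirDerivAt 𝕜 g x y (dg (x, y)))
    (hc : ContinuousOn dg (V ×ˢ univ)) (hx : f x ∈ V) :
    HasDirDerivAt 𝕜 (fun z => g (f z)) x y (dg (f x, w)) := by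
  refine (tendsto_diffQuot hV hd hc (t := id) (l := 𝓝[≠] (0 : 𝕜)) tendsto_id
    (tendsto_const_nhds (x := f x)) hf hx).congr' ?_
  filter_upwards [self_mem_nhdsWithin] with t ht
  have ht : t ≠ 0 := ht
  simp only [id, smul_inv_smul₀ ht, add_sub_cancel]

/-- The increment is split at the intermediate point `x + t y`; the second difference quotient has a
moving base point, which `tendsto_diffQuot` allows. -/
theorem dirDeriv_add [T2Space F] {g : E → F} {dg : E × E → F} {V : Set E} (hV : IsOpen V)
    (hd : ∀ x ∈ V, ∀ y, HasDirDerivAt 𝕜 g x y (dg (x, y)))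
    (hc : ContinuousOn dg (V ×ˢ univ)) {x : E} (hx : x ∈ V) (y z : E) :
    dg (x, y + z) = dg (x, y) + dg (x, z) := by
  have ht : Tendsto id (𝓝[≠] (0 : 𝕜)) (𝓝[≠] 0) := tendsto_id
  have h1 := tendsto_diffQuot hV hd hc ht (tendsto_const_nhds (x := x))
    (tendsto_const_nhds (x := y)) hx
  have h2 := tendsto_diffQuot hV hd hc ht
    ((tendsto_add_smul (𝕜 := 𝕜) x y).mono_left nhdsWithin_le_nhds) (tendsto_const_nhds (x := z)) hx
  refine (hd x hx (y + z)).unique ((h1.add h2).congr fun t => ?_)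
  simp only [id, ← smul_add, add_assoc, sub_add_sub_cancel']

theorem CkOn.exists_hasDifferentialAt [T2Space F] {g : E → F} {V : Set E} (hg : CkOn 𝕜 1 g V)
    (hV : IsOpen V) {x : E} (hx : x ∈ V) : ∃ L : E →L[𝕜] F, HasDifferentialAt 𝕜 g x L := by
  obtain ⟨-, dg, hd, hc⟩ := hg
  refine ⟨⟨⟨⟨fun y => dg (x, y), dirDeriv_add hV hd hc hx⟩, fun c y => ?_⟩, ?_⟩, hd x hx⟩
  · exact (hd x hx (c • y)).unique ((hd x hx y).smul c)
  · exact (ContinuousOn.comp_continuous hc (by fun_prop : Continuous fun y => (x, y))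
      fun y => ⟨hx, mem_univ y⟩ :)

theorem HasDirDerivAt.comp_differential [T2Space F] {D : Type*} [AddCommGroup D] [Module 𝕜 D]
    {f : D → E} {x y : D}
    {w : E} (hf : HasDirDerivAt 𝕜 f x y w) {g : E → F} {V : Set E} (hV : IsOpen V)
    (hg : CkOn 𝕜 1 g V) (hx : f x ∈ V) {L : E →L[𝕜] F} (hL : HasDifferentialAt 𝕜 g (f x) L) :
    HasDirDerivAt 𝕜 (fun z => g (f z)) x y (L w) := by
  obtain ⟨-, dg, hd, hc⟩ := hg
  rw [(hL w).unique (hd _ hx w)]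
  exact hf.comp hV hd hc hx

end Differential

/-! ### Calculus of `C^n`-maps -/

section Ck

variable {𝕜 : Type*} [RCLike 𝕜]

theorem CkOn.continuousOn {F : Type v} [AddCommGroup F] [Module 𝕜 F] [TopologicalSpace F] {n : ℕ}
    {E : Type u} [AddCommGroup E] [Module 𝕜 E] [TopologicalSpace E]
    {f : E → F} {U : Set E} (h : CkOn 𝕜 n f U) : ContinuousOn f U := by
  cases n with
  | zero => exact h
  | succ n => exact h.1

theorem CkOn.mono {F : Type v} [AddCommGroup F] [Module 𝕜 F] [TopologicalSpace F] {n : ℕ}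
    {E : Type u} [AddCommGroup E] [Module 𝕜 E] [TopologicalSpace E]
    {f : E → F} {U U' : Set E} (h : CkOn 𝕜 n f U) (hU : U' ⊆ U) : CkOn 𝕜 n f U' := by
  induction n generalizing E with
  | zero => exact ContinuousOn.mono h hU
  | succ n ih =>
    obtain ⟨hc, df, hd, hdf⟩ := h
    exact ⟨hc.mono hU, df, fun x hx => hd x (hU hx), ih hdf (prod_mono_left hU)⟩

theorem CkOn.of_succ {F : Type v} [AddCommGroup F] [Module 𝕜 F] [TopologicalSpace F] {n : ℕ}
    {E : Type u} [AddCommGroup E] [Module 𝕜 E] [TopologicalSpace E]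
    {f : E → F} {U : Set E} (h : CkOn 𝕜 (n + 1) f U) : CkOn 𝕜 n f U := by
  induction n generalizing E with
  | zero => exact h.1
  | succ n ih =>
    obtain ⟨hc, df, hd, hdf⟩ := h
    exact ⟨hc, df, hd, ih hdf⟩

theorem CkOn.of_le {F : Type v} [AddCommGroup F] [Module 𝕜 F] [TopologicalSpace F] {m n : ℕ}
    {E : Type u} [AddCommGroup E] [Module 𝕜 E] [TopologicalSpace E]
    {f : E → F} {U : Set E} (h : CkOn 𝕜 n f U) (hmn : m ≤ n) : CkOn 𝕜 m f U := by
  induction n, hmn using Nat.le_induction with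
  | base => exact h
  | succ n _ ih => exact ih h.of_succ

theorem CkOn.clm_comp {F : Type v} [AddCommGroup F] [Module 𝕜 F] [TopologicalSpace F]
    {G : Type w} [AddCommGroup G] [Module 𝕜 G] [TopologicalSpace G] (L : F →L[𝕜] G) {n : ℕ}
    {E : Type u} [AddCommGroup E] [Module 𝕜 E] [TopologicalSpace E]
    {f : E → F} {U : Set E} (h : CkOn 𝕜 n f U) : CkOn 𝕜 n (fun x => L (f x)) U := by
  induction n generalizing E with
  | zero => exact L.continuous.comp_continuousOn h
  | succ n ih =>
    obtain ⟨hc, df, hd, hdf⟩ := h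
    exact ⟨L.continuous.comp_continuousOn hc, fun q => L (df q),
      fun x hx y => (hd x hx y).clm_comp L, ih hdf⟩

theorem CkOn.comp_clm {F : Type v} [AddCommGroup F] [Module 𝕜 F] [TopologicalSpace F] {n : ℕ}
    {E : Type u} [AddCommGroup E] [Module 𝕜 E] [TopologicalSpace E]
    {D : Type w} [AddCommGroup D] [Module 𝕜 D] [TopologicalSpace D]
    {f : E → F} {U : Set E} (h : CkOn 𝕜 n f U) (L : D →L[𝕜] E) :
    CkOn 𝕜 n (fun x => f (L x)) (L ⁻¹' U) := by
  induction n generalizing E D with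
  | zero => exact ContinuousOn.comp h L.continuous.continuousOn fun _ hx => hx
  | succ n ih =>
    obtain ⟨hc, df, hd, hdf⟩ := h
    refine ⟨hc.comp L.continuous.continuousOn fun _ hx => hx, fun q => df (L.prodMap L q),
      fun x hx y => ?_, (ih hdf (L.prodMap L)).mono fun q hq => ⟨hq.1, mem_univ _⟩⟩
    simpa [HasDirDerivAt] using hd (L x) hx (L y)

theorem CkOn.prodMk {F : Type v} [AddCommGroup F] [Module 𝕜 F] [TopologicalSpace F]
    {G : Type w} [AddCommGroup G] [Module 𝕜 G] [TopologicalSpace G] {n : ℕ}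
    {E : Type u} [AddCommGroup E] [Module 𝕜 E] [TopologicalSpace E]
    {f : E → F} {g : E → G} {U : Set E} (hf : CkOn 𝕜 n f U) (hg : CkOn 𝕜 n g U) :
    CkOn 𝕜 n (fun x => (f x, g x)) U := by
  induction n generalizing E with
  | zero => exact ContinuousOn.prodMk hf hg
  | succ n ih =>
    obtain ⟨hfc, df, hfd, hdf⟩ := hf
    obtain ⟨hgc, dg, hgd, hdg⟩ := hg
    exact ⟨hfc.prodMk hgc, fun q => (df q, dg q),
      fun x hx y => (hfd x hx y).prodMk (hgd x hx y), ih hdf hdg⟩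

theorem CkOn.add {F : Type v} [AddCommGroup F] [Module 𝕜 F] [TopologicalSpace F]
    [ContinuousAdd F] {n : ℕ}
    {E : Type u} [AddCommGroup E] [Module 𝕜 E] [TopologicalSpace E]
    {f g : E → F} {U : Set E} (hf : CkOn 𝕜 n f U) (hg : CkOn 𝕜 n g U) :
    CkOn 𝕜 n (fun x => f x + g x) U := by
  induction n generalizing E with
  | zero => exact ContinuousOn.add hf hg
  | succ n ih =>
    obtain ⟨hfc, df, hfd, hdf⟩ := hf
    obtain ⟨hgc, dg, hgd, hdg⟩ := hg
    exact ⟨hfc.add hgc, fun q => df q + dg q,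
      fun x hx y => (hfd x hx y).add (hgd x hx y), ih hdf hdg⟩

theorem hasDirDerivAt_linearMap {F : Type*} [AddCommGroup F] [Module 𝕜 F] [TopologicalSpace F]
    {E : Type*} [AddCommGroup E] [Module 𝕜 E] (L : E →ₗ[𝕜] F) (x y : E) :
    HasDirDerivAt 𝕜 L x y (L y) := by
  refine tendsto_const_nhds.congr' ?_
  filter_upwards [self_mem_nhdsWithin] with t ht
  have ht : t ≠ 0 := ht
  simp [smul_smul, ht]

theorem ckOn_clm {F : Type v} [AddCommGroup F] [Module 𝕜 F] [TopologicalSpace F]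
    {E : Type u} [AddCommGroup E] [Module 𝕜 E] [TopologicalSpace E]
    (L : E →L[𝕜] F) (n : ℕ) (U : Set E) : CkOn 𝕜 n L U := by
  induction n generalizing E with
  | zero => exact L.continuous.continuousOn
  | succ n ih =>
    exact ⟨L.continuous.continuousOn, L.comp (ContinuousLinearMap.snd 𝕜 E E),
      fun x _ y => hasDirDerivAt_linearMap (L : E →ₗ[𝕜] F) x y, ih _ _⟩

theorem CkOn.congr {F : Type v} [AddCommGroup F] [Module 𝕜 F] [TopologicalSpace F] {n : ℕ}
    {E : Type u} [AddCommGroup E] [Module 𝕜 E] [TopologicalSpace E] [IsTopologicalAddGroup E]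
    [ContinuousSMul 𝕜 E]
    {f g : E → F} {U : Set E} (h : CkOn 𝕜 n f U) (hU : IsOpen U) (hfg : EqOn f g U) :
    CkOn 𝕜 n g U := by
  cases n with
  | zero => exact ContinuousOn.congr h hfg.symm
  | succ n =>
    obtain ⟨hc, df, hd, hdf⟩ := h
    exact ⟨hc.congr hfg.symm, df,
      fun x hx y => (hd x hx y).congr (hfg.eventuallyEq_of_mem (hU.mem_nhds hx)), hdf⟩

theorem CkOn.comp {F : Type v} [AddCommGroup F] [Module 𝕜 F] [TopologicalSpace F]
    [IsTopologicalAddGroup F] [ContinuousSMul 𝕜 F]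
    {G : Type w} [AddCommGroup G] [Module 𝕜 G] [TopologicalSpace G]
    [IsTopologicalAddGroup G] [ContinuousSMul 𝕜 G] [PolynormableSpace 𝕜 G] {n : ℕ}
    {E : Type u} [AddCommGroup E] [Module 𝕜 E] [TopologicalSpace E]
    {f : E → F} {U : Set E} {g : F → G} {V : Set F} (hg : CkOn 𝕜 n g V) (hf : CkOn 𝕜 n f U)
    (hV : IsOpen V) (hUV : MapsTo f U V) : CkOn 𝕜 n (fun x => g (f x)) U := by
  induction n generalizing E F with
  | zero => exact ContinuousOn.comp hg hf hUV
  | succ n ih =>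
    have hfn := hf.of_succ
    obtain ⟨hfc, df, hfd, hdf⟩ := hf
    obtain ⟨hgc, dg, hgd, hdg⟩ := hg
    refine ⟨hgc.comp hfc hUV, fun q => dg (f q.1, df q),
      fun x hx y => (hfd x hx y).comp hV hgd hdg.continuousOn (hUV hx), ?_⟩
    have h1 : CkOn 𝕜 n (fun q : E × E => f q.1) (U ×ˢ univ) :=
      (hfn.comp_clm (ContinuousLinearMap.fst 𝕜 E E)).mono fun q hq => hq.1
    exact ih hdg (h1.prodMk hdf) (hV.prod isOpen_univ) fun q hq => ⟨hUV hq.1, mem_univ _⟩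

end Ck

/-! ### Power series along lines and Cauchy estimates -/

section OneVariable

variable {B : Type*} [NormedAddCommGroup B] [NormedSpace ℂ B]

theorem hasFPowerSeriesAt_mkPiRing {𝕜 : Type*} [NontriviallyNormedField 𝕜] {B : Type*}
    [NormedAddCommGroup B] [NormedSpace 𝕜 B] {φ : 𝕜 → B} {a : ℕ → B}
    (ha : ∀ᶠ z in 𝓝 (0 : 𝕜), HasSum (fun n => z ^ n • a n) (φ z)) :
    HasFPowerSeriesAt φ
      (show FormalMultilinearSeries 𝕜 𝕜 B from
        fun n => ContinuousMultilinearMap.mkPiRing 𝕜 (Fin n) (a n)) 0 := by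
  rw [hasFPowerSeriesAt_iff]
  simpa [FormalMultilinearSeries.coeff] using ha

theorem coeff_eq_iteratedDeriv [CompleteSpace B] {φ : ℂ → B} {a : ℕ → B} {R : ℝ} (hR : 0 < R)
    (hd : DifferentiableOn ℂ φ (Metric.ball 0 R))
    (ha : ∀ᶠ z in 𝓝 (0 : ℂ), HasSum (fun n => z ^ n • a n) (φ z)) (n : ℕ) :
    a n = (n.factorial : ℂ)⁻¹ • iteratedDeriv n φ 0 := by
  have h2 : ∀ᶠ z in 𝓝 (0 : ℂ),
      HasSum (fun n => z ^ n • ((n.factorial : ℂ)⁻¹ • iteratedDeriv n φ 0)) (φ z) := by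
    filter_upwards [Metric.ball_mem_nhds (0 : ℂ) hR] with z hz
    simpa [smul_comm (z ^ _)] using Complex.hasSum_taylorSeries_on_ball hd hz
  have := (hasFPowerSeriesAt_mkPiRing ha).eq_formalMultilinearSeries (hasFPowerSeriesAt_mkPiRing h2)
  simpa using congrArg (fun m => m fun _ => (1 : ℂ)) (congrFun this n)

/-- Cauchy estimates for the coefficients of a power series. -/
theorem norm_coeff_le [CompleteSpace B] {φ : ℂ → B} {a : ℕ → B} {R C : ℝ} (hR : 0 < R)
    (hd : DiffContOnCl ℂ φ (Metric.ball 0 R)) (hC : ∀ z ∈ Metric.sphere (0 : ℂ) R, ‖φ z‖ ≤ C)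
    (ha : ∀ᶠ z in 𝓝 (0 : ℂ), HasSum (fun n => z ^ n • a n) (φ z)) (n : ℕ) :
    ‖a n‖ ≤ C * R⁻¹ ^ n := by
  rw [coeff_eq_iteratedDeriv hR hd.differentiableOn ha, norm_smul, norm_inv, Complex.norm_natCast,
    inv_mul_le_iff₀ (by positivity)]
  refine (Complex.norm_iteratedDeriv_le_of_forall_mem_sphere_norm_le n hR hd hC).trans_eq ?_
  rw [inv_pow]
  ring

end OneVariable

section Lines

variable {𝕜 : Type*} [RCLike 𝕜] {E : Type u} [AddCommGroup E] [Module 𝕜 E]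

theorem HasDirDerivAt.hasDerivAt {B : Type*} [NormedAddCommGroup B] [NormedSpace 𝕜 B]
    {g : E → B} {x v : E} {w : B} {s : 𝕜} (h : HasDirDerivAt 𝕜 g (x + s • v) v w) :
    HasDerivAt (fun s : 𝕜 => g (x + s • v)) w s := by
  rw [hasDerivAt_iff_tendsto_slope_zero]
  refine Tendsto.congr (fun t => ?_) h
  rw [add_smul, add_assoc]

variable {F : Type v} [AddCommGroup F] [Module 𝕜 F] [TopologicalSpace F] [IsTopologicalAddGroup F]
  [PolynormableSpace 𝕜 F]

theorem hasDirDerivAt_of_hasSum {f : E → F} {x y : E} {a : ℕ → F}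
    (h : ∀ᶠ t in 𝓝 (0 : 𝕜), HasSum (fun n => t ^ n • a n) (f (x + t • y))) :
    HasDirDerivAt 𝕜 f x y (a 1) := by
  refine tendsto_of_forall_clm (𝕜 := 𝕜) fun B _ _ _ L => ?_
  have h1 : ∀ᶠ t in 𝓝 (0 : 𝕜), HasSum (fun n => t ^ n • L (a n)) (L (f (x + t • y))) := by
    filter_upwards [h] with t ht
    simpa using L.hasSum ht
  have h2 := (hasFPowerSeriesAt_mkPiRing h1).hasDerivAt
  rw [hasDerivAt_iff_tendsto_slope_zero] at h2
  simpa using h2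

end Lines

section Cauchy

variable {E : Type u} [AddCommGroup E] [Module ℂ E]
  {F : Type v} [AddCommGroup F] [Module ℂ F] [TopologicalSpace F]

theorem differentiableOn_line {f : E → F} {df : E × E → F} {U : Set E}
    (hd : ∀ x ∈ U, ∀ y, HasDirDerivAt ℂ f x y (df (x, y)))
    {B : Type*} [NormedAddCommGroup B] [NormedSpace ℂ B] (L : F →L[ℂ] B) (x y : E) {S : Set ℂ}
    (hS : ∀ s ∈ S, x + s • y ∈ U) :
    DifferentiableOn ℂ (fun s : ℂ => L (f (x + s • y))) S := fun s hs =>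
  ((hd _ (hS s hs) y).clm_comp L).hasDerivAt.differentiableAt.differentiableWithinAt

theorem deriv_line {f : E → F} {df : E × E → F} {U : Set E}
    (hd : ∀ x ∈ U, ∀ y, HasDirDerivAt ℂ f x y (df (x, y)))
    {B : Type*} [NormedAddCommGroup B] [NormedSpace ℂ B] (L : F →L[ℂ] B) {x : E} (y : E)
    (hx : x ∈ U) : HasDerivAt (fun s : ℂ => L (f (x + s • y))) (L (df (x, y))) 0 := by
  have h := ((hd _ hx y).clm_comp L)
  rw [← add_zero x, ← zero_smul ℂ y] at h
  simpa using h.hasDerivAt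

/-- A continuous map with complex directional derivatives has a continuous differential. -/
theorem continuousOn_dirDeriv [TopologicalSpace E] [IsTopologicalAddGroup E]
    [ContinuousSMul ℂ E] [IsTopologicalAddGroup F] [PolynormableSpace ℂ F]
    {f : E → F} {df : E × E → F} {U : Set E} (hU : IsOpen U)
    (hc : ContinuousOn f U) (hd : ∀ x ∈ U, ∀ y, HasDirDerivAt ℂ f x y (df (x, y))) :
    ContinuousOn df (U ×ˢ univ) := by
  rintro ⟨x₀, y₀⟩ ⟨hx₀, -⟩
  refine ContinuousAt.continuousWithinAt (tendsto_of_forall_clm (𝕜 := ℂ) fun B _ _ _ L => ?_)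
  have h0 : ∀ᶠ s in 𝓝 (0 : ℂ), x₀ + s • y₀ ∈ U :=
    (tendsto_add_smul x₀ y₀).eventually (hU.mem_nhds hx₀)
  obtain ⟨ρ, hρ, hρU⟩ := Metric.nhds_basis_closedBall.eventually_iff.1 h0
  rw [Metric.tendsto_nhds]
  intro ε hε
  -- On a compact disc of radius `ρ` the restrictions of `L ∘ f` to the two lines differ by less
  -- than `ε / 2 * ρ`; Cauchy's estimate for the derivative at `0` divides by `ρ`.
  have key : ∀ᶠ q : E × E in 𝓝 (x₀, y₀), ∀ s ∈ Metric.closedBall (0 : ℂ) ρ,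
      q.1 + s • q.2 ∈ U ∧ ‖L (f (q.1 + s • q.2)) - L (f (x₀ + s • y₀))‖ < ε / 2 * ρ := by
    refine (isCompact_closedBall 0 ρ).eventually_forall_of_forall_eventually fun s hs => ?_
    have h1 : Tendsto (fun q : (E × E) × ℂ => q.1.1 + q.2 • q.1.2) (𝓝 ((x₀, y₀), s))
        (𝓝 (x₀ + s • y₀)) := Continuous.tendsto (by fun_prop) _
    have h2 : Tendsto (fun q : (E × E) × ℂ => x₀ + q.2 • y₀) (𝓝 ((x₀, y₀), s))
        (𝓝 (x₀ + s • y₀)) := Continuous.tendsto (by fun_prop) ((x₀, y₀), s)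
    have hf : Tendsto (fun z => L (f z)) (𝓝 (x₀ + s • y₀)) (𝓝 (L (f (x₀ + s • y₀)))) :=
      L.continuous.continuousAt.comp (hc.continuousAt (hU.mem_nhds (hρU hs)))
    have h3 := ((hf.comp h1).sub (hf.comp h2)).norm
    rw [sub_self, norm_zero] at h3
    filter_upwards [h1.eventually (hU.mem_nhds (hρU hs)),
      h3.eventually (gt_mem_nhds (show 0 < ε / 2 * ρ by positivity))] with q hq1 hq2
    exact ⟨hq1, hq2⟩
  filter_upwards [key] with q hq
  have hdiff : DifferentiableOn ℂ
      (fun s : ℂ => L (f (q.1 + s • q.2)) - L (f (x₀ + s • y₀))) (Metric.closedBall 0 ρ) :=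
    (differentiableOn_line hd L _ _ fun s hs => (hq s hs).1).sub
      (differentiableOn_line hd L _ _ fun s hs => hρU hs)
  have hq1 : q.1 ∈ U := by simpa using (hq 0 (by simpa using hρ.le)).1
  have := Complex.norm_deriv_le_of_forall_mem_sphere_norm_le hρ
    (hdiff.diffContOnCl_ball Subset.rfl)
    fun s hs => (hq s (Metric.sphere_subset_closedBall hs)).2.le
  rw [((deriv_line hd L q.2 hq1).fun_sub (deriv_line hd L y₀ hx₀)).deriv,
    mul_div_cancel_right₀ _ hρ.ne'] at this
  rw [dist_eq_norm]
  simp only [Prod.mk.eta] at this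
  linarith

end Cauchy

/-! ### Differentials of complex analytic maps -/

section Series

variable {E : Type u} [AddCommGroup E] [Module ℂ E] [TopologicalSpace E]
  {F : Type v} [AddCommGroup F] [Module ℂ F] [TopologicalSpace F]

/-- The part of degree `n` in the expansion of the differential at `(x, y)`, for a map whose
expansion at `x` is given by `p`. -/
noncomputable def diffSeries [IsTopologicalAddGroup F]
    (p : (n : ℕ) → ContinuousMultilinearMap ℂ (fun _ : Fin n => E) F)
    (y : E) (n : ℕ) : ContinuousMultilinearMap ℂ (fun _ : Fin n => E × E) F :=
  -- At `(x + z.1, y + z.2)` the differential is the sum of those in the directions `y` and `z.2`.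
  -- Differentiating in the fixed direction `y` lowers the degree in `z`, so `p (n + 1)` contributes
  -- to degree `n`; inserting the variable `z.2` keeps the degree, so `p n` does too.
  (∑ i : Fin (n + 1), { ((p (n + 1)).toMultilinearMap.curryMid i y).compLinearMap
        (fun _ => LinearMap.fst ℂ E E) with
      cont := by
        change Continuous fun z : Fin n → E × E => p (n + 1) (i.insertNth y fun j => (z j).1)
        refine (p (n + 1)).cont.comp ?_
        exact Continuous.finInsertNth i continuous_const (by fun_prop) }) +
  ∑ i : Fin n, (p n).compContinuousLinearMap fun j =>
    if j = i then ContinuousLinearMap.snd ℂ E E else ContinuousLinearMap.fst ℂ E E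

theorem diffSeries_apply [IsTopologicalAddGroup F]
    (p : (n : ℕ) → ContinuousMultilinearMap ℂ (fun _ : Fin n => E) F)
    (y : E) (n : ℕ) (z : E × E) : diffSeries p y n (fun _ => z) =
      ∑ i, p (n + 1) (Function.update (fun _ => z.1) i y) +
        ∑ i, p n (Function.update (fun _ => z.1) i z.2) := by
  rw [diffSeries, add_apply, sum_apply, sum_apply]
  congr 1
  · refine Finset.sum_congr rfl fun i _ => ?_
    change p (n + 1) (i.insertNth y fun j => z.1) = _
    congr 1
    funext j
    cases j using Fin.succAboveCases i <;> simp
  · refine Finset.sum_congr rfl fun i _ => ?_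
    rw [ContinuousMultilinearMap.compContinuousLinearMap_apply]
    congr 1
    funext j
    rcases eq_or_ne j i with rfl | hj <;> simp [*]

variable [IsTopologicalAddGroup E] [ContinuousSMul ℂ E]

/-- As `E` carries no norm, `p` is pulled back along `(a, b) ↦ a • u + b • y` to a multilinear map
on the normed space `ℂ × ℂ`, where the known derivative applies. -/
theorem hasDerivAt_multilinear_line {B : Type*} [NormedAddCommGroup B] [NormedSpace ℂ B] {n : ℕ}
    (p : ContinuousMultilinearMap ℂ (fun _ : Fin n => E) F) (L : F →L[ℂ] B) (u y : E) (s : ℂ) :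
    HasDerivAt (fun s : ℂ => L (p fun _ => u + s • y))
      (L (∑ i, p (Function.update (fun _ => u + s • y) i y))) s := by
  let A : ℂ × ℂ →L[ℂ] E := (ContinuousLinearMap.fst ℂ ℂ ℂ).smulRight u +
    (ContinuousLinearMap.snd ℂ ℂ ℂ).smulRight y
  let q := (L.compContinuousMultilinearMap p).compContinuousLinearMap fun _ => A
  have h1 : HasDerivAt (fun s : ℂ => fun _ : Fin n => ((1 : ℂ), s)) (fun _ => (0, 1)) s :=
    hasDerivAt_pi.2 fun _ => (hasDerivAt_const s (1 : ℂ)).prodMk (hasDerivAt_id s)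
  have h2 := (q.hasFDerivAt fun _ => (1, s)).comp_hasDerivAt s h1
  have h3 : (q.linearDeriv fun _ => (1, s)) (fun _ => (0, 1)) =
      L (∑ i, p (Function.update (fun _ => u + s • y) i y)) := by
    rw [ContinuousMultilinearMap.linearDeriv_apply, map_sum]
    refine Finset.sum_congr rfl fun i _ => ?_
    simp only [q, ContinuousMultilinearMap.compContinuousLinearMap_apply,
      ContinuousLinearMap.compContinuousMultilinearMap_coe, Function.comp_apply]
    congr 2
    funext j
    rcases eq_or_ne j i with rfl | hj <;> simp [A, *]
  rw [h3] at h2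
  refine h2.congr_of_eventuallyEq (Eventually.of_forall fun s => ?_)
  simp [q, A]

/-- An interior point leaves room for a real factor `R > 1`, uniformly for nearby points of the
line; balancedness extends this to complex factors in the disc. The radius above `1` is what gives
geometric decay of Taylor coefficients. -/
theorem exists_one_lt_smul_mem {W : Set E} (hWb : Balanced ℂ W) {u : E} (hu : u ∈ interior W)
    (y : E) : ∃ R > (1 : ℝ), ∃ ρ > (0 : ℝ), ∀ r ∈ Metric.closedBall (0 : ℂ) R,
      ∀ s ∈ Metric.closedBall (0 : ℂ) ρ, r • (u + s • y) ∈ W := by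
  have h : Tendsto (fun q : ℝ × ℂ => ((q.1 : ℂ)) • (u + q.2 • y)) (𝓝 (1, 0)) (𝓝 u) :=
    Continuous.tendsto' (by fun_prop) _ _ (by simp)
  have h' := h.eventually (mem_interior_iff_mem_nhds.1 hu)
  rw [nhds_prod_eq] at h'
  obtain ⟨P, hP, Q, hQ, hPQ⟩ := eventually_prod_iff.1 h'
  obtain ⟨ρ, hρ, hρQ⟩ := Metric.nhds_basis_closedBall.eventually_iff.1 hQ
  obtain ⟨R, hRP, hR⟩ := ((hP.filter_mono nhdsWithin_le_nhds).and
    (self_mem_nhdsWithin : Ioi (1 : ℝ) ∈ 𝓝[>] 1)).exists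
  have hR : 1 < R := hR
  refine ⟨R, hR, ρ, hρ, fun r hr s hs => ?_⟩
  have := hWb.smul_mem (a := r / R) (by
    rw [norm_div, Complex.norm_real, Real.norm_of_nonneg (by linarith)]
    exact (div_le_one (by linarith)).2 (by simpa using hr)) (hPQ hRP (hρQ hs))
  rwa [smul_smul, div_mul_cancel₀] at this
  exact_mod_cast (by linarith : R ≠ 0)

variable [IsTopologicalAddGroup F]

/-- The series is differentiated term by term along `s ↦ u + s • y`. Cauchy estimates in the scaling
variable on the circle of radius `R > 1` give the summable majorant `C * R⁻¹ ^ n`, uniformly in `s`.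
-/
theorem hasSum_dirDeriv [PolynormableSpace ℂ F] {f : E → F} {df : E × E → F} {U : Set E}
    (hc : ContinuousOn f U) (hd : ∀ x ∈ U, ∀ y, HasDirDerivAt ℂ f x y (df (x, y))) {x : E}
    {p : (n : ℕ) → ContinuousMultilinearMap ℂ (fun _ : Fin n => E) F} {W : Set E}
    (hWb : Balanced ℂ W) (hWU : ∀ z ∈ W, x + z ∈ U)
    (hp : ∀ z ∈ W, HasSum (fun n => p n fun _ => z) (f (x + z))) {u : E} (hu : u ∈ interior W)
    (y : E) :
    HasSum (fun n => ∑ i, p n (Function.update (fun _ => u) i y)) (df (x + u, y)) := by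
  refine tendsto_of_forall_clm (𝕜 := ℂ) fun B _ _ _ L => ?_
  obtain ⟨R, hR, ρ, hρ, hRρ⟩ := exists_one_lt_smul_mem hWb hu y
  have hR0 : 0 < R := by linarith
  obtain ⟨C, hC⟩ : ∃ C, ∀ q ∈ Metric.closedBall (0 : ℂ) R ×ˢ Metric.closedBall (0 : ℂ) ρ,
      ‖L (f (x + q.1 • (u + q.2 • y)))‖ ≤ C := by
    refine ((isCompact_closedBall _ _).prod (isCompact_closedBall _ _)).exists_bound_of_continuousOn
      (L.continuous.comp_continuousOn (hc.comp (by fun_prop) ?_))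
    exact fun q hq => hWU _ (hRρ _ hq.1 _ hq.2)
  have hbound : ∀ n : ℕ, ∀ s ∈ Metric.closedBall (0 : ℂ) ρ,
      ‖L (p n fun _ => u + s • y)‖ ≤ C * R⁻¹ ^ n := by
    intro n s hs
    refine norm_coeff_le (a := fun n => L (p n fun _ => u + s • y))
      (φ := fun r => L (f (x + r • (u + s • y)))) hR0
      ((differentiableOn_line hd L _ _ fun r hr => hWU _ (hRρ _ hr _ hs)).diffContOnCl_ball
        Subset.rfl) (fun r hr => hC (r, s) ⟨Metric.sphere_subset_closedBall hr, hs⟩) ?_ n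
    filter_upwards [Metric.closedBall_mem_nhds (0 : ℂ) hR0] with r hr
    simpa [ContinuousMultilinearMap.map_smul_univ, -smul_add] using L.hasSum (hp _ (hRρ _ hr _ hs))
  have hsum : Summable fun n => C * R⁻¹ ^ n :=
    (summable_geometric_of_lt_one (by positivity) (inv_lt_one_of_one_lt₀ hR)).mul_left C
  have h1 := Complex.hasSum_deriv_of_summable_norm hsum
    (F := fun n s => L (p n fun _ => u + s • y)) (U := Metric.ball 0 ρ) (z := 0)
    (fun n s _ =>
      (hasDerivAt_multilinear_line (p n) L u y s).differentiableAt.differentiableWithinAt)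
    Metric.isOpen_ball (fun n s hs => hbound n s (Metric.ball_subset_closedBall hs))
    (Metric.mem_ball_self hρ)
  have h2 : (fun s : ℂ => ∑' n, L (p n fun _ => u + s • y)) =ᶠ[𝓝 0]
      fun s => L (f ((x + u) + s • y)) := by
    filter_upwards [Metric.closedBall_mem_nhds (0 : ℂ) hρ] with s hs
    have hm : u + s • y ∈ W := by
      simpa using hRρ 1 (by simpa using hR.le) s hs
    rw [add_assoc]
    exact (L.hasSum (hp _ hm)).tsum_eq
  rw [h2.deriv_eq, (deriv_line hd L y (hWU u (interior_subset hu))).deriv] at h1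
  simp_rw [fun n => (hasDerivAt_multilinear_line (p n) L u y 0).deriv, zero_smul, add_zero] at h1
  simpa only [HasSum, map_sum] using h1

/-- This is the induction step for `C^n`-regularity: the differential is the degree-one term of the
expansion, and it is itself expanded by `diffSeries`. -/
theorem SeriesAnalyticOn.dirDeriv [ContinuousSMul ℂ F] [PolynormableSpace ℂ F] [T2Space F]
    {f : E → F} {U : Set E} (hU : IsOpen U) (hf : SeriesAnalyticOn ℂ f U) : ∃ df : E × E → F,
      (∀ x ∈ U, ∀ y : E, HasDirDerivAt ℂ f x y (df (x, y))) ∧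
        SeriesAnalyticOn ℂ df (U ×ˢ univ) := by
  obtain ⟨hc, hp⟩ := hf
  choose! p hp using hp
  let df : E × E → F := fun q => p q.1 1 fun _ => q.2
  have hd : ∀ x ∈ U, ∀ y : E, HasDirDerivAt ℂ f x y (df (x, y)) := by
    intro x hx y
    refine hasDirDerivAt_of_hasSum (a := fun n => p x n fun _ => y) ?_
    have ht : Tendsto (fun t : ℂ => t • y) (𝓝 0) (𝓝 0) :=
      Continuous.tendsto' (by fun_prop) _ _ (by simp)
    filter_upwards [ht.eventually (hp x hx)] with t ht
    simpa [ContinuousMultilinearMap.map_smul_univ] using ht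
  have hdc := continuousOn_dirDeriv hU hc hd
  refine ⟨df, hd, hdc, ?_⟩
  rintro ⟨x, y⟩ ⟨hx, -⟩
  refine ⟨diffSeries (p x) y, ?_⟩
  have hW : ∀ᶠ z in 𝓝 (0 : E), x + z ∈ U ∧ HasSum (fun n => p x n fun _ => z) (f (x + z)) := by
    refine Eventually.and ?_ (hp x hx)
    have : Tendsto (fun z : E => x + z) (𝓝 0) (𝓝 x) :=
      Continuous.tendsto' (by fun_prop) _ _ (by simp)
    exact this.eventually (hU.mem_nhds hx)
  obtain ⟨W, ⟨hW0, hWb⟩, hW⟩ := (nhds_basis_balanced ℂ E).eventually_iff.1 hW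
  have h0 : ∀ᶠ z : E × E in 𝓝 0, z.1 ∈ interior W :=
    continuous_fst.continuousAt.preimage_mem_nhds (interior_mem_nhds.2 hW0)
  filter_upwards [h0] with z hz
  have hsum := hasSum_dirDeriv hc hd hWb (fun z hz => (hW hz).1) (fun z hz => (hW hz).2) hz
  have h1 := hsum y
  rw [← add_zero (df _)] at h1
  -- The degree-zero term is an empty sum, so dropping it and shifting the index aligns this series
  -- with the one in the direction `z.2`.
  have h1' := (hasSum_nat_add_iff' 1).2 h1
  simp only [add_zero, Finset.range_one, Finset.sum_singleton, Finset.univ_eq_empty,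
    Finset.sum_empty, sub_zero] at h1'
  have := h1'.add (hsum z.2)
  simp_rw [diffSeries_apply]
  rwa [← dirDeriv_add hU hd hdc (hW (interior_subset hz)).1] at this

theorem SeriesAnalyticOn.ckOn {F : Type v} [AddCommGroup F] [Module ℂ F] [TopologicalSpace F]
    [IsTopologicalAddGroup F] [ContinuousSMul ℂ F] [PolynormableSpace ℂ F] [T2Space F] (n : ℕ)
    {E : Type u} [AddCommGroup E] [Module ℂ E] [TopologicalSpace E] [IsTopologicalAddGroup E]
    [ContinuousSMul ℂ E] {f : E → F} {U : Set E}
    (hf : SeriesAnalyticOn ℂ f U) (hU : IsOpen U) : CkOn ℂ n f U := by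
  induction n generalizing E with
  | zero => exact hf.1
  | succ n ih =>
    obtain ⟨df, hd, hdf⟩ := hf.dirDeriv hU
    exact ⟨hf.1, df, hd, ih hdf (hU.prod isOpen_univ)⟩

end Series

/-! ### Iterated directional derivatives and Taylor series -/

section IteratedDirDeriv

variable {𝕜 : Type*} [RCLike 𝕜]

/-- The directional derivative of `f` at `x` in the direction `y`, if it exists. -/
noncomputable def dirD (𝕜 : Type*) [RCLike 𝕜] {E : Type u} {F : Type v}
    [AddCommGroup E] [Module 𝕜 E] [AddCommGroup F] [Module 𝕜 F] [TopologicalSpace F]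
    (f : E → F) (x y : E) : F :=
  Classical.epsilon (HasDirDerivAt 𝕜 f x y)

/-- The iterated directional derivative of `f` at `x` in the directions `y 0, …, y (n - 1)`. -/
noncomputable def iterDirD (𝕜 : Type*) [RCLike 𝕜] {E : Type u} {F : Type v}
    [AddCommGroup E] [Module 𝕜 E] [AddCommGroup F] [Module 𝕜 F] [TopologicalSpace F] :
    (n : ℕ) → (E → F) → E → (Fin n → E) → F
  | 0, f, x, _ => f x
  | n + 1, f, x, y => iterDirD 𝕜 n (fun z => dirD 𝕜 f z (y 0)) x (Fin.tail y)

variable {F : Type v} [AddCommGroup F] [Module 𝕜 F] [TopologicalSpace F]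

theorem HasDirDerivAt.dirD_eq [T2Space F] {E : Type u} [AddCommGroup E] [Module 𝕜 E]
    {f : E → F} {x y : E} {w : F}
    (h : HasDirDerivAt 𝕜 f x y w) : dirD 𝕜 f x y = w :=
  (Classical.epsilon_spec ⟨w, h⟩).unique h

/-- Freezing the second argument amounts to a direction with zero second component. The two
derivative predicates coincide, so `epsilon` selects the same value even where no derivative exists.
-/
theorem dirD_slice {E : Type u} [AddCommGroup E] [Module 𝕜 E] {E' : Type w} [AddCommGroup E']
    [Module 𝕜 E'] (f : E × E' → F) (x y : E) (y₀ : E') :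
    dirD 𝕜 (fun z => f (z, y₀)) x y = dirD 𝕜 f (x, y₀) (y, 0) := by
  have : HasDirDerivAt 𝕜 (fun z => f (z, y₀)) x y = HasDirDerivAt 𝕜 f (x, y₀) (y, 0) := by
    funext w
    simp [HasDirDerivAt]
  rw [dirD, dirD, this]

theorem iterDirD_slice {E : Type u} [AddCommGroup E] [Module 𝕜 E] {E' : Type w} [AddCommGroup E']
    [Module 𝕜 E'] {n : ℕ} (f : E × E' → F) (x : E) (y₀ : E') (y : Fin n → E) :
    iterDirD 𝕜 n (fun z => f (z, y₀)) x y = iterDirD 𝕜 n f (x, y₀) fun i => (y i, 0) := by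
  induction n generalizing f with
  | zero => rfl
  | succ n ih =>
    simp only [iterDirD, dirD_slice]
    exact ih (fun q => dirD 𝕜 f q (y 0, 0)) (Fin.tail y)

theorem ckOn_const {n : ℕ} {E : Type u} [AddCommGroup E] [Module 𝕜 E] [TopologicalSpace E]
    (c : F) (U : Set E) : CkOn 𝕜 n (fun _ => c) U := by
  induction n generalizing E c with
  | zero => exact continuousOn_const
  | succ n ih =>
    refine ⟨continuousOn_const, fun _ => 0, fun x _ y => ?_, ih 0 _⟩
    simpa [HasDirDerivAt] using tendsto_const_nhds

variable {E : Type u} [AddCommGroup E] [Module 𝕜 E] [TopologicalSpace E]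
  [IsTopologicalAddGroup E] [ContinuousSMul 𝕜 E]

theorem dirD_congr {f g : E → F} {U : Set E} (hU : IsOpen U) (h : EqOn f g U) (y : E) :
    EqOn (fun x => dirD 𝕜 f x y) (fun x => dirD 𝕜 g x y) U := by
  intro x hx
  have : HasDirDerivAt 𝕜 f x y = HasDirDerivAt 𝕜 g x y := funext fun w => propext
    ⟨fun hf => hf.congr (h.eventuallyEq_of_mem (hU.mem_nhds hx)),
      fun hg => hg.congr (h.symm.eventuallyEq_of_mem (hU.mem_nhds hx))⟩
  simp only [dirD, this]

theorem iterDirD_congr {n : ℕ} {f g : E → F} {U : Set E} (hU : IsOpen U) (h : EqOn f g U) {x : E}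
    (hx : x ∈ U) (y : Fin n → E) : iterDirD 𝕜 n f x y = iterDirD 𝕜 n g x y := by
  induction n generalizing f g with
  | zero => exact h hx
  | succ n ih => exact ih (dirD_congr hU h _) _

theorem CkOn.dirD [T2Space F] {n : ℕ} {f : E → F} {U : Set E} (hU : IsOpen U)
    (hf : CkOn 𝕜 (n + 1) f U) : CkOn 𝕜 n (fun q : E × E => dirD 𝕜 f q.1 q.2) (U ×ˢ univ) := by
  obtain ⟨-, df, hd, hdf⟩ := hf
  exact hdf.congr (hU.prod isOpen_univ) fun q hq => ((hd q.1 hq.1 q.2).dirD_eq).symm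

variable [IsTopologicalAddGroup F] [ContinuousSMul 𝕜 F] [PolynormableSpace 𝕜 F]

theorem CkOn.slice {E' : Type u} [AddCommGroup E'] [Module 𝕜 E'] [TopologicalSpace E']
    [IsTopologicalAddGroup E'] [ContinuousSMul 𝕜 E']
    {n : ℕ} {f : E × E' → F} {U : Set E} (hU : IsOpen U) (hf : CkOn 𝕜 n f (U ×ˢ univ)) (y : E') :
    CkOn 𝕜 n (fun x => f (x, y)) U :=
  hf.comp ((ckOn_clm (ContinuousLinearMap.id 𝕜 E) n U).prodMk (ckOn_const y U))
    (hU.prod isOpen_univ) fun _ hx => ⟨hx, mem_univ _⟩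

variable [T2Space F]

theorem CkOn.dirD_const {n : ℕ} {f : E → F} {U : Set E} (hU : IsOpen U)
    (hf : CkOn 𝕜 (n + 1) f U) (y : E) : CkOn 𝕜 n (fun x => LCCalculus.dirD 𝕜 f x y) U :=
  (hf.dirD hU).slice hU y

theorem iterDirD_add {n : ℕ} {f g : E → F} {U : Set E} (hU : IsOpen U) (hf : CkOn 𝕜 n f U)
    (hg : CkOn 𝕜 n g U) {x : E} (hx : x ∈ U) (y : Fin n → E) :
    iterDirD 𝕜 n (fun z => f z + g z) x y = iterDirD 𝕜 n f x y + iterDirD 𝕜 n g x y := by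
  induction n generalizing f g with
  | zero => rfl
  | succ n ih =>
    have hf' := hf.dirD_const hU (y 0)
    have hg' := hg.dirD_const hU (y 0)
    obtain ⟨-, df, hdf, -⟩ := hf
    obtain ⟨-, dg, hdg, -⟩ := hg
    simp only [iterDirD]
    rw [← ih hf' hg']
    refine iterDirD_congr hU (fun z hz => ?_) hx _
    rw [((hdf z hz (y 0)).add (hdg z hz (y 0))).dirD_eq, (hdf z hz (y 0)).dirD_eq,
      (hdg z hz (y 0)).dirD_eq]

theorem iterDirD_smul {n : ℕ} {f : E → F} {U : Set E} (hU : IsOpen U) (hf : CkOn 𝕜 n f U)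
    (c : 𝕜) {x : E} (hx : x ∈ U) (y : Fin n → E) :
    iterDirD 𝕜 n (fun z => c • f z) x y = c • iterDirD 𝕜 n f x y := by
  induction n generalizing f with
  | zero => rfl
  | succ n ih =>
    have hf' := hf.dirD_const hU (y 0)
    obtain ⟨-, df, hdf, -⟩ := hf
    simp only [iterDirD]
    rw [← ih hf']
    refine iterDirD_congr hU (fun z hz => ?_) hx _
    have h : HasDirDerivAt 𝕜 (fun z => c • f z) z (y 0) (c • df (z, y 0)) :=
      (hdf z hz (y 0)).clm_comp (c • ContinuousLinearMap.id 𝕜 F)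
    rw [h.dirD_eq, (hdf z hz (y 0)).dirD_eq]

/-- Slot `0` is linearity of the differential, and the other slots follow by induction; symmetry of
higher derivatives is not needed. -/
theorem iterDirD_update_add {n : ℕ} {f : E → F} {U : Set E} (hU : IsOpen U) (hf : CkOn 𝕜 n f U)
    {x : E} (hx : x ∈ U) (y : Fin n → E) (i : Fin n) (a b : E) :
    iterDirD 𝕜 n f x (Function.update y i (a + b)) =
      iterDirD 𝕜 n f x (Function.update y i a) + iterDirD 𝕜 n f x (Function.update y i b) := by
  induction n generalizing f with
  | zero => exact i.elim0
  | succ n ih =>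
    have hf' := hf.dirD_const hU
    cases i using Fin.cases with
    | zero =>
      obtain ⟨-, df, hd, hdf⟩ := hf
      simp only [iterDirD, Function.update_self, Fin.tail_update_zero]
      rw [← iterDirD_add hU (hf' a) (hf' b) hx]
      refine iterDirD_congr hU (fun z hz => ?_) hx _
      rw [(hd z hz _).dirD_eq, (hd z hz _).dirD_eq, (hd z hz _).dirD_eq,
        dirDeriv_add hU hd hdf.continuousOn hz]
    | succ i =>
      have h0 : ∀ e, Function.update y i.succ e 0 = y 0 := fun e =>
        Function.update_of_ne (Fin.succ_ne_zero i).symm _ _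
      simp only [iterDirD, h0, Fin.tail_update_succ]
      exact ih (hf' _) _ _

theorem iterDirD_update_smul {n : ℕ} {f : E → F} {U : Set E} (hU : IsOpen U) (hf : CkOn 𝕜 n f U)
    {x : E} (hx : x ∈ U) (y : Fin n → E) (i : Fin n) (c : 𝕜) (a : E) :
    iterDirD 𝕜 n f x (Function.update y i (c • a)) =
      c • iterDirD 𝕜 n f x (Function.update y i a) := by
  induction n generalizing f with
  | zero => exact i.elim0
  | succ n ih =>
    have hf' := hf.dirD_const hU
    cases i using Fin.cases with
    | zero =>
      obtain ⟨-, df, hd, hdf⟩ := hf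
      simp only [iterDirD, Function.update_self, Fin.tail_update_zero]
      rw [← iterDirD_smul hU (hf' a) c hx]
      refine iterDirD_congr hU (fun z hz => ?_) hx _
      rw [(hd z hz a).dirD_eq, ((hd z hz a).smul c).dirD_eq]
    | succ i =>
      have h0 : ∀ e, Function.update y i.succ e 0 = y 0 := fun e =>
        Function.update_of_ne (Fin.succ_ne_zero i).symm _ _
      simp only [iterDirD, h0, Fin.tail_update_succ]
      exact ih (hf' _) _ _

/-- For joint continuity the first direction is absorbed into the base point: the derivative of
order `n + 1` of `f` is one of order `n` of the differential on `E × E`, in the directions `(y i,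
0)`. -/
theorem continuousOn_iterDirD {F : Type v} [AddCommGroup F] [Module 𝕜 F] [TopologicalSpace F]
    [T2Space F] [IsTopologicalAddGroup F] [ContinuousSMul 𝕜 F] [PolynormableSpace 𝕜 F] {n : ℕ}
    {E : Type u} [AddCommGroup E] [Module 𝕜 E] [TopologicalSpace E]
    [IsTopologicalAddGroup E] [ContinuousSMul 𝕜 E] {f : E → F} {U : Set E} (hU : IsOpen U)
    (hf : CkOn 𝕜 n f U) :
    ContinuousOn (fun q : E × (Fin n → E) => iterDirD 𝕜 n f q.1 q.2) (U ×ˢ univ) := by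
  induction n generalizing E with
  | zero => exact ContinuousOn.comp hf continuousOn_fst fun q hq => hq.1
  | succ n ih =>
    have h := ih (hU.prod isOpen_univ) (hf.dirD hU)
    have hc : Continuous fun q : E × (Fin (n + 1) → E) =>
        (((q.1, q.2 0), fun i => (q.2 i.succ, 0)) : (E × E) × (Fin n → E × E)) := by fun_prop
    refine (h.comp hc.continuousOn fun q hq => ⟨⟨hq.1, mem_univ _⟩, mem_univ _⟩).congr
      fun q hq => ?_
    exact iterDirD_slice (fun z : E × E => LCCalculus.dirD 𝕜 f z.1 z.2) q.1 (q.2 0) (Fin.tail q.2)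

/-- The homogeneous Taylor polynomials, as multilinear maps. -/
noncomputable def taylorTerm {n : ℕ} {f : E → F} {U : Set E} (hU : IsOpen U) (hf : CkOn 𝕜 n f U)
    {x : E} (hx : x ∈ U) : ContinuousMultilinearMap 𝕜 (fun _ : Fin n => E) F where
  toMultilinearMap := (n.factorial : 𝕜)⁻¹ • MultilinearMap.mk' (iterDirD 𝕜 n f x)
    (fun y i a b => iterDirD_update_add hU hf hx y i a b)
    (fun y i c a => iterDirD_update_smul hU hf hx y i c a)
  cont := by
    change Continuous fun y => (n.factorial : 𝕜)⁻¹ • iterDirD 𝕜 n f x y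
    refine Continuous.const_smul ?_ _
    exact (continuousOn_iterDirD hU hf).comp_continuous (by fun_prop : Continuous fun y => (x, y))
      fun y => ⟨hx, mem_univ _⟩

end IteratedDirDeriv

section Taylor

variable {E : Type u} [AddCommGroup E] [Module ℂ E] [TopologicalSpace E] [IsTopologicalAddGroup E]
  [ContinuousSMul ℂ E]
  {F : Type v} [AddCommGroup F] [Module ℂ F] [TopologicalSpace F] [IsTopologicalAddGroup F]
  [ContinuousSMul ℂ F] [PolynormableSpace ℂ F] [T2Space F]

theorem iteratedDeriv_line {n : ℕ} {f : E → F} {U : Set E} (hU : IsOpen U) (hf : CkOn ℂ n f U)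
    {x : E} (hx : x ∈ U) (y : E) {B : Type*} [NormedAddCommGroup B] [NormedSpace ℂ B]
    (L : F →L[ℂ] B) :
    iteratedDeriv n (fun s : ℂ => L (f (x + s • y))) 0 = L (iterDirD ℂ n f x fun _ => y) := by
  induction n generalizing f with
  | zero => simp [iterDirD]
  | succ n ih =>
    rw [iteratedDeriv_succ']
    have h := ih (hf.dirD_const hU y)
    simp only [iterDirD]
    refine Eq.trans ?_ h
    refine Filter.EventuallyEq.iteratedDeriv_eq n ?_
    obtain ⟨-, df, hd, -⟩ := hf
    filter_upwards [(tendsto_add_smul x y).eventually (hU.mem_nhds hx)] with s hs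
    rw [((hd _ hs y).clm_comp L).hasDerivAt.deriv, (hd _ hs y).dirD_eq]

/-- On a complex line `s ↦ x + s • y` with `y` small, `L ∘ f` is holomorphic on a disc of radius
greater than `1`, hence equals its Taylor series at `s = 1`. The coefficients are the images under
`L` of the `taylorTerm`s on the diagonal. -/
theorem seriesAnalyticOn_of_ckOn {f : E → F} {U : Set E} (hU : IsOpen U)
    (hf : ∀ n : ℕ, CkOn ℂ n f U) : SeriesAnalyticOn ℂ f U := by
  refine ⟨hf 0, fun x hx => ⟨fun n => taylorTerm hU (hf n) hx, ?_⟩⟩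
  have hd : ∀ z ∈ U, ∀ y, HasDirDerivAt ℂ f z y (dirD ℂ f z y) := by
    obtain ⟨-, df, hd, -⟩ := hf 1
    intro z hz y
    rw [(hd z hz y).dirD_eq]
    exact hd z hz y
  have hW : ∀ᶠ z in 𝓝 (0 : E), x + z ∈ U := by
    have : Tendsto (fun z : E => x + z) (𝓝 0) (𝓝 x) :=
      Continuous.tendsto' (by fun_prop) _ _ (by simp)
    exact this.eventually (hU.mem_nhds hx)
  obtain ⟨W, ⟨hW0, hWb⟩, hW⟩ := (nhds_basis_balanced ℂ E).eventually_iff.1 hW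
  filter_upwards [interior_mem_nhds.2 hW0] with y hy
  refine tendsto_of_forall_clm (𝕜 := ℂ) fun B _ _ _ L => ?_
  obtain ⟨R, hR, ρ, hρ, hRρ⟩ := exists_one_lt_smul_mem hWb hy 0
  have hball : ∀ s ∈ Metric.ball (0 : ℂ) R, x + s • y ∈ U := fun s hs => hW (by
    simpa using hRρ s (Metric.ball_subset_closedBall hs) 0 (Metric.mem_closedBall_self hρ.le))
  have h := Complex.hasSum_taylorSeries_on_ball
    (differentiableOn_line (df := fun q => dirD ℂ f q.1 q.2)
    hd L x y hball) (z := 1) (by simpa using hR)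
  have e : ∀ n : ℕ, L (taylorTerm hU (hf n) hx fun _ => y) =
      (n.factorial : ℂ)⁻¹ • ((1 : ℂ) - 0) ^ n •
        iteratedDeriv n (fun s : ℂ => L (f (x + s • y))) 0 := by
    intro n
    rw [iteratedDeriv_line hU (hf n) hx, sub_zero, one_pow, one_smul, ← map_smul]
    rfl
  simpa only [HasSum, map_sum, e, one_smul] using h

end Taylor

/-! ### Change of the scalar field -/

section BaseChange

variable {K K' : Type*} [RCLike K] [RCLike K'] {τ : K →+* K'}

theorem HasDirDerivAt.baseChange (hτ : Continuous τ)
    {E : Type*} [AddCommGroup E] [Module K E] [Module K' E]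
    (hE : ∀ (c : K) (v : E), τ c • v = c • v)
    {F : Type*} [AddCommGroup F] [TopologicalSpace F] [Module K F] [Module K' F]
    (hF : ∀ (c : K) (v : F), τ c • v = c • v) {f : E → F} {x y : E} {w : F}
    (h : HasDirDerivAt K' f x y w) : HasDirDerivAt K f x y w := by
  refine (Tendsto.comp h (tendsto_nhdsNE_zero_of_continuous hτ)).congr fun t => ?_
  simp only [Function.comp_apply, ← map_inv₀, hE, hF]

theorem CkOn.baseChange (hτ : Continuous τ)
    {F : Type v} [AddCommGroup F] [TopologicalSpace F] [Module K F] [Module K' F]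
    (hF : ∀ (c : K) (v : F), τ c • v = c • v) {n : ℕ}
    {E : Type u} [AddCommGroup E] [TopologicalSpace E] [Module K E] [Module K' E]
    (hE : ∀ (c : K) (v : E), τ c • v = c • v)
    {f : E → F} {U : Set E} (h : CkOn K' n f U) : CkOn K n f U := by
  induction n generalizing E with
  | zero => exact h
  | succ n ih =>
    obtain ⟨hc, df, hd, hdf⟩ := h
    exact ⟨hc, df, fun x hx y => (hd x hx y).baseChange hτ hE hF,
      ih (fun c v => Prod.ext (hE c v.1) (hE c v.2)) hdf⟩

theorem SeriesAnalyticOn.baseChange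
    {F : Type v} [AddCommGroup F] [TopologicalSpace F] [Module K F] [Module K' F]
    (hF : ∀ (c : K) (v : F), τ c • v = c • v)
    {E : Type u} [AddCommGroup E] [TopologicalSpace E] [Module K E] [Module K' E]
    (hE : ∀ (c : K) (v : E), τ c • v = c • v)
    {f : E → F} {U : Set E} (h : SeriesAnalyticOn K' f U) : SeriesAnalyticOn K f U := by
  refine ⟨h.1, fun x hx => ?_⟩
  obtain ⟨p, hp⟩ := h.2 x hx
  exact ⟨fun n =>
    { toFun := p n
      map_update_add' := fun m i a b => (p n).map_update_add m i a b
      map_update_smul' := fun m i c a => by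
        rw [← hE, ← hF, (p n).map_update_smul]
      cont := (p n).cont }, hp⟩

end BaseChange

section RestrictScalars

variable {𝕜 : Type*} [RCLike 𝕜]

theorem ofReal_smul_eq {F : Type*} [AddCommGroup F] [Module 𝕜 F] [Module ℝ F] [IsScalarTower ℝ 𝕜 F]
    (t : ℝ) (v : F) : (t : 𝕜) • v = t • v := by
  rw [← RCLike.real_smul_eq_coe_smul (K := 𝕜)]

/-- The norm is only homogeneous over `ℝ`, as for the sup norm on a complexification. Multiplication
by `I` is nevertheless a bounded real operator, and this controls all scalars. -/
theorem exists_norm_smul_le (B : Type*) [NormedAddCommGroup B] [NormedSpace ℝ B] [Module 𝕜 B]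
    [IsScalarTower ℝ 𝕜 B] [ContinuousSMul 𝕜 B] :
    ∃ K : ℝ, 0 < K ∧ ∀ (c : 𝕜) (v : B), ‖c • v‖ ≤ K * (‖c‖ * ‖v‖) := by
  let J : B →L[ℝ] B := (RCLike.I : 𝕜) • ContinuousLinearMap.id ℝ B
  refine ⟨1 + ‖J‖, by positivity, fun c v => ?_⟩
  have e : c • v = RCLike.re c • v + RCLike.im c • J v := by
    rw [← ofReal_smul_eq (𝕜 := 𝕜), ← ofReal_smul_eq (𝕜 := 𝕜)]
    change c • v = (RCLike.re c : 𝕜) • v + (RCLike.im c : 𝕜) • ((RCLike.I : 𝕜) • v)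
    rw [smul_smul, ← add_smul, RCLike.re_add_im]
  calc ‖c • v‖ ≤ |RCLike.re c| * ‖v‖ + |RCLike.im c| * ‖J v‖ := by
        rw [e]
        refine (norm_add_le _ _).trans_eq ?_
        rw [norm_smul, norm_smul, Real.norm_eq_abs, Real.norm_eq_abs]
    _ ≤ ‖c‖ * ‖v‖ + ‖c‖ * (‖J‖ * ‖v‖) := by
        gcongr
        · exact RCLike.abs_re_le_norm c
        · exact RCLike.abs_im_le_norm c
        · exact J.le_opNorm v
    _ = _ := by ring

end RestrictScalars

/-! ### From Bastiani differentiability to Fréchet differentiability -/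

section Frechet

variable {B : Type u} [NormedAddCommGroup B] [NormedSpace ℝ B]
  {B' : Type v} [NormedAddCommGroup B'] [NormedSpace ℝ B']

/-- The differential of a `C^2`-map between normed spaces is continuous in the operator norm. -/
theorem CkOn.continuousOn_differential {f : B → B'} {U : Set B} (hU : IsOpen U)
    (hf : CkOn ℝ 2 f U) {D : B → B →L[ℝ] B'} (hD : ∀ x ∈ U, HasDifferentialAt ℝ f x (D x)) :
    ContinuousOn D U := by
  obtain ⟨-, df, hd, hdc, ddf, hdd, hddc⟩ := hf
  have hDd : ∀ x ∈ U, ∀ y, D x y = df (x, y) := fun x hx y => (hD x hx y).unique (hd x hx y)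
  intro x hx
  have h0 : ddf ((x, 0), (0, 0)) = 0 := by
    have := (hdd (x, 0) ⟨hx, mem_univ _⟩ 0).smul (0 : ℝ)
    rw [zero_smul, zero_smul] at this
    exact (hdd (x, 0) ⟨hx, mem_univ _⟩ 0).unique this
  have hcont : Tendsto ddf (𝓝 ((x, 0), (0, 0))) (𝓝 0) := by
    rw [← h0]
    exact (ContinuousOn.continuousAt hddc (((hU.prod isOpen_univ).prod isOpen_univ).mem_nhds
      ⟨⟨hx, mem_univ _⟩, mem_univ _⟩)).tendsto
  -- The second differential vanishes at `((x, 0), (0, 0))`, so by continuity it is bounded by `1`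
  -- on some ball around that point.
  have hev : ∀ᶠ q : (B × B) × (B × B) in 𝓝 ((x, 0), (0, 0)), ‖ddf q‖ ≤ 1 ∧ q.1.1 ∈ U := by
    refine Eventually.and ?_ ?_
    · filter_upwards [hcont.eventually (Metric.closedBall_mem_nhds 0 one_pos)] with q hq
      simpa using hq
    · exact (continuous_fst.comp continuous_fst).continuousAt.preimage_mem_nhds (hU.mem_nhds hx)
  obtain ⟨δ, hδ, hball⟩ := Metric.nhds_basis_closedBall.eventually_iff.1 hev
  -- Each factor `δ⁻¹` comes from scaling one of the two linear arguments, `y` and `x' - x`, to norm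
  -- `δ`, where the bound `1` is available.
  have key : ∀ x' ∈ Metric.closedBall x δ, ‖D x' - D x‖ ≤ δ⁻¹ * δ⁻¹ * ‖x' - x‖ := by
    intro x' hx'
    have hseg : ∀ s ∈ Icc (0 : ℝ) 1, x + s • (x' - x) ∈ Metric.closedBall x δ := fun s hs =>
      (convex_closedBall x δ).add_smul_sub_mem (Metric.mem_closedBall_self hδ.le) hx' hs
    have hmem : ∀ z ∈ Metric.closedBall x δ, ∀ y h : B, ‖y‖ ≤ δ → ‖h‖ ≤ δ →
        ‖ddf ((z, y), (h, 0))‖ ≤ 1 ∧ z ∈ U := by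
      intro z hz y h hy hh
      refine hball (x := ((z, y), (h, 0))) ?_
      simp only [Metric.mem_closedBall, Prod.dist_eq, dist_zero_right, dist_self]
      exact max_le (max_le hz hy) (max_le hh hδ.le)
    have hzU : ∀ z ∈ Metric.closedBall x δ, z ∈ U := fun z hz =>
      (hmem z hz 0 0 (by simpa using hδ.le) (by simpa using hδ.le)).2
    refine ContinuousLinearMap.opNorm_le_of_unit_norm (by positivity) fun y hy => ?_
    have hyδ : ‖δ • y‖ ≤ δ := by rw [norm_smul, hy, mul_one, Real.norm_of_nonneg hδ.le]
    have hmv : ‖df (x', δ • y) - df (x, δ • y) - 0‖ ≤ δ⁻¹ * ‖x' - x‖ := by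
      have := norm_sub_sub_le_of_hasDirDerivAt (𝕜 := ℝ) (g := fun z => df (z, δ • y)) (x := x)
        (v := x' - x) (dg := fun q => ddf ((q.1, δ • y), (q.2, 0))) (w := 0)
        (ε := δ⁻¹ * ‖x' - x‖) ?_ ?_
      · simpa using this
      · intro s hs
        have := hdd (x + s • (x' - x), δ • y) ⟨hzU _ (hseg s hs), mem_univ _⟩ (x' - x, 0)
        simpa [HasDirDerivAt] using this
      · intro s hs
        rw [sub_zero]
        rcases eq_or_ne x' x with rfl | hne
        · have := (hdd (x' + s • (x' - x'), δ • y) ⟨hzU _ (hseg s hs), mem_univ _⟩ 0).smul (0 : ℝ)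
          rw [zero_smul, zero_smul] at this
          have h00 := (hdd (x' + s • (x' - x'), δ • y)
            ⟨hzU _ (hseg s hs), mem_univ _⟩ 0).unique this
          simp only [sub_self, norm_zero, mul_zero, norm_le_zero_iff]
          simpa only [sub_self, smul_zero, add_zero] using! h00
        · have hr : 0 < ‖x' - x‖ := norm_pos_iff.2 (sub_ne_zero.2 hne)
          set r := ‖x' - x‖ with hrdef
          have hh : ‖(δ * r⁻¹) • (x' - x)‖ ≤ δ := by
            rw [norm_smul, Real.norm_of_nonneg (by positivity), ← hrdef, mul_assoc,
              inv_mul_cancel₀ hr.ne', mul_one]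
          have h1 := (hmem _ (hseg s hs) (δ • y) _ hyδ hh).1
          have h2 := (hdd (x + s • (x' - x), δ • y) ⟨hzU _ (hseg s hs), mem_univ _⟩
            ((δ * r⁻¹) • (x' - x), 0)).unique (by
              simpa using (hdd (x + s • (x' - x), δ • y) ⟨hzU _ (hseg s hs), mem_univ _⟩
                (x' - x, 0)).smul (δ * r⁻¹))
          rw [h2, norm_smul, Real.norm_of_nonneg (by positivity)] at h1
          rw [show δ⁻¹ * r = (δ * r⁻¹)⁻¹ by rw [mul_inv, inv_inv], ← one_div,
            le_div_iff₀' (by positivity)]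
          exact h1
    rw [sub_zero, ← hDd x' (hzU x' hx'), ← hDd x hx, map_smul, map_smul, ← smul_sub, norm_smul,
      Real.norm_of_nonneg hδ.le] at hmv
    rw [sub_apply, mul_assoc]
    rwa [← div_eq_inv_mul _ δ, le_div_iff₀' hδ]
  refine ContinuousAt.continuousWithinAt ?_
  rw [ContinuousAt, tendsto_iff_norm_sub_tendsto_zero]
  refine squeeze_zero' (Eventually.of_forall fun _ => norm_nonneg _)
    (g := fun x' => δ⁻¹ * δ⁻¹ * ‖x' - x‖) ?_ ?_
  · filter_upwards [Metric.closedBall_mem_nhds x hδ] with x' hx' using key x' hx'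
  · exact Continuous.tendsto' (by fun_prop) _ _ (by simp)

theorem hasFDerivAt_of_hasDifferentialAt {f : B → B'} {U : Set B} (hU : IsOpen U)
    {D : B → B →L[ℝ] B'} (hD : ∀ x ∈ U, HasDifferentialAt ℝ f x (D x)) (hc : ContinuousOn D U)
    {x : B} (hx : x ∈ U) : HasFDerivAt f (D x) x := by
  rw [hasFDerivAt_iff_isLittleO_nhds_zero, Asymptotics.isLittleO_iff]
  intro ε hε
  have h1 : ∀ᶠ z in 𝓝 x, ‖D z - D x‖ ≤ ε ∧ z ∈ U := by
    refine Eventually.and ?_ (hU.mem_nhds hx)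
    filter_upwards [(hc.continuousAt (hU.mem_nhds hx)).tendsto.eventually
      (Metric.closedBall_mem_nhds _ hε)] with z hz
    rwa [← dist_eq_norm]
  obtain ⟨δ, hδ, hball⟩ := Metric.nhds_basis_closedBall.eventually_iff.1 h1
  filter_upwards [Metric.closedBall_mem_nhds (0 : B) hδ] with h hh
  have hseg : ∀ s ∈ Icc (0 : ℝ) 1, x + s • h ∈ Metric.closedBall x δ := fun s hs => by
    simpa using (convex_closedBall x δ).add_smul_sub_mem (y := x + h)
      (Metric.mem_closedBall_self hδ.le) (by simpa using hh) hs
  refine norm_sub_sub_le_of_hasDirDerivAt (𝕜 := ℝ) (dg := fun q => D q.1 q.2)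
    (fun s hs => hD _ (hball (hseg s hs)).2 h) fun s hs => ?_
  exact ((D (x + s • h) - D x).le_opNorm h).trans
    (mul_le_mul_of_nonneg_right (hball (hseg s hs)).1 (norm_nonneg h))

end Frechet

/-! ### Inverse function theorem for `C^n`-maps -/

section Inverse

variable {𝕜 : Type*} [RCLike 𝕜]

/-- Inversion of a `C^n`-family of continuous linear automorphisms is `C^n` if it is continuous. -/
theorem CkOn.symm_apply {G : Type u} [AddCommGroup G] [Module 𝕜 G] [TopologicalSpace G]
    [IsTopologicalAddGroup G] [ContinuousSMul 𝕜 G] [PolynormableSpace 𝕜 G] {n : ℕ}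
    {A : G × G → G} {W : Set G} (hW : IsOpen W) (hA : CkOn 𝕜 n A (W ×ˢ univ))
    {e : G → G ≃L[𝕜] G} (he : ∀ x ∈ W, ∀ w, e x w = A (x, w))
    (hc : ContinuousOn (fun q : G × G => (e q.1).symm q.2) (W ×ˢ univ)) :
    CkOn 𝕜 n (fun q : G × G => (e q.1).symm q.2) (W ×ˢ univ) := by
  induction n with
  | zero => exact hc
  | succ n ih =>
    have hI := ih hA.of_succ
    obtain ⟨-, dA, hd, hdA⟩ := hA
    -- The formula results from differentiating `A (x, (e x)⁻¹ z) = z`; linearity of `A` in its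
    -- second argument leaves only the derivative in the direction `(u, 0)`.
    refine ⟨hc, fun q => (e q.1.1).symm (q.2.2 - dA ((q.1.1, (e q.1.1).symm q.1.2), (q.2.1, 0))),
      ?_, ?_⟩
    · rintro ⟨x, z⟩ ⟨hx, -⟩ ⟨u, v⟩
      set w := (e x).symm z with hw
      have hq := hd (x, w) ⟨hx, mem_univ _⟩ (u, 0)
      have hxt : Tendsto (fun t : 𝕜 => x + t • u) (𝓝[≠] 0) (𝓝 x) := by
        refine Tendsto.mono_left ?_ nhdsWithin_le_nhds
        have h1 : Tendsto (fun t : 𝕜 => t • u) (𝓝 0) (𝓝 0) := by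
          simpa using (tendsto_id (x := 𝓝 (0 : 𝕜))).smul_const u
        simpa using h1.const_add x
      -- The difference quotient of the inverse is exactly `(e (x + t u))⁻¹` applied to this second
      -- component, so continuity of the inverse yields the limit.
      have h2 : Tendsto (fun t : 𝕜 => (x + t • u, v - t⁻¹ • (A ((x, w) + t • (u, 0)) - A (x, w))))
          (𝓝[≠] 0) (𝓝 (x, v - dA ((x, w), (u, 0)))) := hxt.prodMk_nhds (hq.const_sub v)
      have h3 := ((hc.continuousAt ((hW.prod isOpen_univ).mem_nhds
        (show (x, v - dA ((x, w), (u, 0))) ∈ W ×ˢ univ from ⟨hx, mem_univ _⟩))).tendsto).comp h2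
      refine h3.congr' ?_
      filter_upwards [hxt.eventually (hW.mem_nhds hx), self_mem_nhdsWithin] with t htW ht
      have ht : t ≠ 0 := ht
      have e1 : A (x, w) = z := by rw [← he x hx, hw, ContinuousLinearEquiv.apply_symm_apply]
      have e2 : A ((x, w) + t • (u, 0)) = e (x + t • u) w := by
        rw [he _ htW]
        simp
      simp only [Function.comp_apply]
      rw [e1, e2]
      apply (e (x + t • u)).injective
      simp only [Prod.smul_mk, Prod.mk_add_mk, map_smul, map_sub,
        ContinuousLinearEquiv.apply_symm_apply]
      rw [← hw, show z + t • v - e (x + t • u) w = t • v - (e (x + t • u) w - z) by abel,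
        smul_sub t⁻¹ (t • v), inv_smul_smul₀ ht, smul_sub]
    · have hmap : CkOn 𝕜 n (fun q : (G × G) × (G × G) =>
          ((q.1.1, (e q.1.1).symm q.1.2), (q.2.1, (0 : G)))) ((W ×ˢ univ) ×ˢ univ) := by
        have h1 : CkOn 𝕜 n (fun q : (G × G) × (G × G) => (e q.1.1).symm q.1.2)
            ((W ×ˢ univ) ×ˢ univ) :=
          (hI.comp_clm (ContinuousLinearMap.fst 𝕜 (G × G) (G × G))).mono fun q hq => hq.1
        exact ((ckOn_clm ((ContinuousLinearMap.fst 𝕜 G G).comp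
          (ContinuousLinearMap.fst 𝕜 (G × G) (G × G))) n _).prodMk h1).prodMk
          ((ckOn_clm ((ContinuousLinearMap.fst 𝕜 G G).comp
            (ContinuousLinearMap.snd 𝕜 (G × G) (G × G))) n _).prodMk (ckOn_const 0 _))
      have h2 := (hdA.comp hmap ((hW.prod isOpen_univ).prod isOpen_univ)
        fun q hq => ⟨⟨hq.1.1, mem_univ _⟩, mem_univ _⟩).clm_comp (-ContinuousLinearMap.id 𝕜 G)
      have h3 := (ckOn_clm ((ContinuousLinearMap.snd 𝕜 G G).comp
            (ContinuousLinearMap.snd 𝕜 (G × G) (G × G))) n ((W ×ˢ univ) ×ˢ univ)).add h2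
      have h4 := (ckOn_clm ((ContinuousLinearMap.fst 𝕜 G G).comp
            (ContinuousLinearMap.fst 𝕜 (G × G) (G × G))) n ((W ×ˢ univ) ×ˢ univ)).prodMk h3
      have h5 := hI.comp h4 (hW.prod isOpen_univ) fun q hq => ⟨hq.1.1, mem_univ _⟩
      simpa [sub_eq_add_neg] using h5

/-- A continuous local inverse whose directional derivatives are given by the inverses of the
differentials is as smooth as the original map. -/
theorem CkOn.localInverse {G : Type u} [AddCommGroup G] [Module 𝕜 G] [TopologicalSpace G]
    [IsTopologicalAddGroup G] [ContinuousSMul 𝕜 G] [PolynormableSpace 𝕜 G] {I : G × G → G}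
    {W V : Set G} (hW : IsOpen W) {g : G → G} (hg : ContinuousOn g V)
    (hgW : MapsTo g V W) (hd : ∀ y ∈ V, ∀ z, HasDirDerivAt 𝕜 g y z (I (g y, z))) {n : ℕ}
    (hI : CkOn 𝕜 n I (W ×ˢ univ)) : CkOn 𝕜 (n + 1) g V := by
  suffices ∀ m ≤ n, CkOn 𝕜 (m + 1) g V from this n le_rfl
  -- Bootstrapping: the differential of `g` is `I (g y, z)`, so it is as regular as `g` already is,
  -- and `g` gains one order.
  have hstep : ∀ m ≤ n, CkOn 𝕜 m g V → CkOn 𝕜 (m + 1) g V := by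
    intro m hm h
    refine ⟨hg, fun q => I (g q.1, q.2), hd, ?_⟩
    refine (hI.of_le hm).comp (V := W ×ˢ univ)
      (CkOn.prodMk ?_ (ckOn_clm (ContinuousLinearMap.snd 𝕜 G G) m _)) (hW.prod isOpen_univ)
      fun q hq => ⟨hgW hq.1, mem_univ _⟩
    exact (h.comp_clm (ContinuousLinearMap.fst 𝕜 G G)).mono fun q hq => hq.1
  intro m
  induction m with
  | zero => exact fun hm => hstep 0 hm hg
  | succ m ih => exact fun hm => hstep _ hm (ih (Nat.le_of_succ_le hm))

variable {B : Type u} [NormedAddCommGroup B] [NormedSpace ℝ B] [Module 𝕜 B]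
  [IsScalarTower ℝ 𝕜 B] [ContinuousSMul 𝕜 B]

theorem hasDirDerivAt_of_hasFDerivAt {g : B → B} {L : B →L[ℝ] B} {y : B}
    (h : HasFDerivAt g L y) (hL : ∀ (c : 𝕜) z, L (c • z) = c • L z) (z : B) :
    HasDirDerivAt 𝕜 g y z (L z) := by
  obtain ⟨K, hK, hKs⟩ := exists_norm_smul_le (𝕜 := 𝕜) B
  rw [hasFDerivAt_iff_isLittleO_nhds_zero] at h
  have ht : Tendsto (fun t : 𝕜 => t • z) (𝓝[≠] 0) (𝓝 0) :=
    (Continuous.tendsto' (by fun_prop) _ _ (by simp)).mono_left nhdsWithin_le_nhds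
  rw [HasDirDerivAt, Metric.tendsto_nhds]
  intro ε hε
  -- One factor `K` pays for multiplication by `t⁻¹`, the other for `‖t • z‖`; the summand `1`
  -- covers `z = 0`.
  have hη : 0 < ε / 2 / (K * K * (‖z‖ + 1)) := by positivity
  filter_upwards [ht.eventually (h.def hη), self_mem_nhdsWithin] with t h1 h2
  have h2 : t ≠ 0 := h2
  rw [dist_eq_norm]
  have e : t⁻¹ • (g (y + t • z) - g y) - L z = t⁻¹ • (g (y + t • z) - g y - L (t • z)) := by
    rw [hL, smul_sub t⁻¹ (_ - _), inv_smul_smul₀ h2]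
  have ht0 : 0 < ‖t‖ := norm_pos_iff.2 h2
  calc ‖t⁻¹ • (g (y + t • z) - g y) - L z‖
      ≤ K * (‖t⁻¹‖ * (ε / 2 / (K * K * (‖z‖ + 1)) * (K * (‖t‖ * ‖z‖)))) := by
        rw [e]
        refine (hKs _ _).trans ?_
        gcongr
        exact h1.trans (by gcongr; exact hKs _ _)
    _ = ε / 2 * (‖z‖ / (‖z‖ + 1)) := by
        rw [norm_inv]
        field_simp
    _ ≤ ε / 2 * 1 := by
        gcongr
        exact (div_le_one (by positivity)).2 (by linarith)
    _ < ε := by linarith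

/-- Inverse function theorem. -/
theorem exists_localInverse [CompleteSpace B] [PolynormableSpace 𝕜 B] {f : B → B} {U : Set B}
    (hU : IsOpen U) (hf : CkOn 𝕜 1 f U)
    (hreg : CkOn 𝕜 2 f U ∨ FiniteDimensional ℝ B) {x₀ : B} (hx₀ : x₀ ∈ U)
    (hd₀ : HasDifferentialAt 𝕜 f x₀ (ContinuousLinearMap.id 𝕜 B)) :
    ∃ Φ : OpenPartialHomeomorph B B, x₀ ∈ Φ.source ∧ Φ.source ⊆ U ∧ (∀ x, Φ x = f x) ∧
      ∀ n : ℕ, CkOn 𝕜 n f U → CkOn 𝕜 n Φ.symm Φ.target := by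
  have hL : ∀ x ∈ U, ∃ L : B →L[𝕜] B, HasDifferentialAt 𝕜 f x L := fun x hx =>
    hf.exists_hasDifferentialAt hU hx
  choose! L hL using hL
  let D : B → B →L[ℝ] B := fun x => (L x).restrictScalars ℝ
  have hD : ∀ x ∈ U, HasDifferentialAt ℝ f x (D x) := fun x hx y =>
    (hL x hx y).baseChange (τ := algebraMap ℝ 𝕜) RCLike.continuous_ofReal
      (algebraMap_smul 𝕜) (algebraMap_smul 𝕜)
  -- Operator norm continuity comes from the second differential in the `C^2` case; in finite
  -- dimensions it is the same as pointwise continuity.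
  have hDc : ContinuousOn D U := by
    rcases hreg with h2 | hfin
    · exact (h2.baseChange (τ := algebraMap ℝ 𝕜) RCLike.continuous_ofReal (algebraMap_smul 𝕜)
        (algebraMap_smul 𝕜)).continuousOn_differential hU hD
    · rw [continuousOn_clm_apply]
      intro y
      obtain ⟨-, df, hdf, hc⟩ := hf
      refine (ContinuousOn.comp hc (by fun_prop : Continuous fun x => (x, y)).continuousOn
        fun x hx => ⟨hx, mem_univ y⟩).congr fun x hx => ?_
      exact (hL x hx y).unique (hdf x hx y)
  have hFD : ∀ x ∈ U, HasFDerivAt f (D x) x := fun x hx =>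
    hasFDerivAt_of_hasDifferentialAt hU hD hDc hx
  have hstrict : HasStrictFDerivAt f (ContinuousLinearEquiv.refl ℝ B : B →L[ℝ] B) x₀ := by
    have := hasStrictFDerivAt_of_hasFDerivAt_of_continuousAt
      (Filter.eventually_of_mem (hU.mem_nhds hx₀) hFD) (hDc.continuousAt (hU.mem_nhds hx₀))
    convert this using 1
    ext y
    exact (hd₀ y).unique (hL x₀ hx₀ y)
  let R : Set (B →L[ℝ] B) := range ContinuousLinearEquiv.toContinuousLinearMap
  let W : Set B := U ∩ D ⁻¹' R
  have hWo : IsOpen W := hDc.isOpen_inter_preimage hU ContinuousLinearEquiv.isOpen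
  have hx₀W : x₀ ∈ W := by
    refine ⟨hx₀, ContinuousLinearEquiv.refl ℝ B, ?_⟩
    ext y
    exact (hd₀ y).unique (hL x₀ hx₀ y)
  -- The inverse of a `𝕜`-linear bijection is `𝕜`-linear, so real invertibility already gives a
  -- `𝕜`-linear equivalence.
  have hE : ∀ x ∈ W, ∃ e : B ≃L[𝕜] B, (∀ y, e y = L x y) ∧ ∀ y, e.symm y = (D x).inverse y := by
    rintro x ⟨hx, e, he⟩
    have he' : ∀ y, e y = L x y := fun y => congrArg (fun T : B →L[ℝ] B => T y) he
    refine ⟨{ (L x).toLinearMap with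
      invFun := e.symm
      left_inv := fun y => (congrArg e.symm (he' y)).symm.trans (e.symm_apply_apply y)
      right_inv := fun y => (he' _).symm.trans (e.apply_symm_apply y)
      continuous_toFun := (L x).continuous
      continuous_invFun := e.symm.continuous }, fun y => rfl, fun y => ?_⟩
    rw [← he, ContinuousLinearMap.inverse_equiv]
    rfl
  choose! e he he' using hE
  have hIc : ContinuousOn (fun q : B × B => (e q.1).symm q.2) (W ×ˢ univ) := by
    have h1 : ContinuousOn (fun x => (D x).inverse) W := by
      rintro x ⟨hx, e, he⟩
      have h2 : ContinuousAt (ContinuousLinearMap.inverse : (B →L[ℝ] B) → B →L[ℝ] B) (D x) := by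
        rw [← ContinuousLinearMap.ringInverse_eq_inverse]
        have := NormedRing.inverse_continuousAt ((ContinuousLinearEquiv.unitsEquiv ℝ B).symm e)
        rwa [show (((ContinuousLinearEquiv.unitsEquiv ℝ B).symm e : (B →L[ℝ] B)ˣ) : B →L[ℝ] B) = D x
          from he] at this
      exact (h2.comp (hDc.continuousAt (hU.mem_nhds hx))).continuousWithinAt
    have h2 : ContinuousOn (fun q : B × B => (D q.1).inverse q.2) (W ×ˢ univ) :=
      ContinuousOn.clm_apply (h1.comp continuousOn_fst fun q hq => hq.1) continuousOn_snd
    exact h2.congr fun q hq => he' q.1 hq.1 q.2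
  let Φ := (hstrict.toOpenPartialHomeomorph f).restrOpen W hWo
  have hΦ : ∀ x, Φ x = f x := fun x => congrFun hstrict.toOpenPartialHomeomorph_coe x
  have hsrc : Φ.source ⊆ W := by
    rw [OpenPartialHomeomorph.restrOpen_source]
    exact inter_subset_right
  refine ⟨Φ, ?_, fun x hx => (hsrc hx).1, hΦ, fun n hn => ?_⟩
  · rw [OpenPartialHomeomorph.restrOpen_source]
    exact ⟨hstrict.mem_toOpenPartialHomeomorph_source, hx₀W⟩
  cases n with
  | zero => exact Φ.continuousOn_symm
  | succ n =>
    have hgW : MapsTo Φ.symm Φ.target W := fun y hy => hsrc (Φ.map_target hy)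
    obtain ⟨-, df, hdf, hdfn⟩ := hn
    refine CkOn.localInverse (I := fun q => (e q.1).symm q.2) hWo Φ.continuousOn_symm hgW
      (fun y hy z => ?_) (hdfn.mono (prod_mono_left fun x hx => hx.1) |>.symm_apply hWo
        (fun x hx w => (he x hx w).trans ((hL x hx.1 w).unique (hdf x hx.1 w))) hIc)
    have hx := hgW hy
    let eR : B ≃L[ℝ] B := (e (Φ.symm y)).restrictScalars ℝ
    have h1 : HasFDerivAt Φ (eR : B →L[ℝ] B) (Φ.symm y) := by
      have h2 := hFD _ hx.1
      have h3 : (eR : B →L[ℝ] B) = D (Φ.symm y) := by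
        ext w
        exact he _ hx w
      rw [h3]
      exact h2.congr_of_eventuallyEq (Eventually.of_forall hΦ)
    exact hasDirDerivAt_of_hasFDerivAt (Φ.hasFDerivAt_symm hy h1)
      (fun c z => (e (Φ.symm y)).symm.map_smul c z) z

end Inverse

/-! ### Analytic maps as `C^n`-maps, and complexification -/

section LocallyConvex

open scoped ComplexOrder in
/-- Real locally convex topological `𝕜`-vector spaces are polynormable. -/
theorem polynormableSpace_of_locallyConvexSpace (𝕜 : Type*) [RCLike 𝕜] (F : Type*) [AddCommGroup F]
    [Module 𝕜 F] [TopologicalSpace F] [IsTopologicalAddGroup F] [ContinuousSMul 𝕜 F] [Module ℝ F]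
    [IsScalarTower ℝ 𝕜 F] [LocallyConvexSpace ℝ F] : PolynormableSpace 𝕜 F := by
  have : ContinuousSMul ℝ F := IsScalarTower.continuousSMul 𝕜
  have : LocallyConvexSpace 𝕜 F := by
    refine ⟨fun x => (LocallyConvexSpace.convex_basis (𝕜 := ℝ) x).to_hasBasis
      (fun s hs => ⟨s, ⟨hs.1, ?_⟩, Subset.rfl⟩) fun s hs => ⟨s, ⟨hs.1, hs.2.lift ℝ⟩, Subset.rfl⟩⟩
    exact convex_of_nonneg_surjective_algebraMap _
        (fun _ => RCLike.nonneg_iff_exists_ofReal.mp) hs.2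
  infer_instance

variable {𝕜 : Type*} [RCLike 𝕜] {E : Type u} [AddCommGroup E] [Module 𝕜 E]

theorem isScalarTower_compHom :
    let _ : Module ℝ E := Module.compHom E (algebraMap ℝ 𝕜)
    IsScalarTower ℝ 𝕜 E := by
  intro _
  refine ⟨fun r c v => ?_⟩
  rw [Algebra.smul_def, mul_smul]
  rfl

variable [TopologicalSpace E]

theorem locallyConvexSpace_compHom [PolynormableSpace 𝕜 E] :
    let _ : Module ℝ E := Module.compHom E (algebraMap ℝ 𝕜)
    LocallyConvexSpace ℝ E := by
  intro _
  have : IsScalarTower ℝ 𝕜 E := isScalarTower_compHom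
  exact (PolynormableSpace.withSeminorms 𝕜 E).toLocallyConvexSpace

variable [IsTopologicalAddGroup E] [ContinuousSMul 𝕜 E]

/-- If `I ≠ 0`, then `𝕜` is isomorphic to `ℂ` as a topological field. Both notions are transported
along this isomorphism, which reduces the claim to `ℂ`. -/
theorem seriesAnalyticOn_iff_ckOn_of_I_ne_zero (hI : (RCLike.I : 𝕜) ≠ 0)
    {F : Type v} [AddCommGroup F] [Module 𝕜 F] [TopologicalSpace F] [IsTopologicalAddGroup F]
    [ContinuousSMul 𝕜 F] [PolynormableSpace 𝕜 F] [T2Space F] {f : E → F} {U : Set E}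
    (hU : IsOpen U) : SeriesAnalyticOn 𝕜 f U ↔ ∀ n : ℕ, CkOn 𝕜 n f U := by
  have hI' : RCLike.im (RCLike.I : 𝕜) = 1 := RCLike.I_eq_zero_or_im_I_eq_one.resolve_left hI
  let σ : 𝕜 ≃+* ℂ := RCLike.complexRingEquiv hI'
  have hσ : Continuous (σ : 𝕜 →+* ℂ) := (RCLike.complexLinearIsometryEquiv hI').continuous
  have hσ' : Continuous (σ.symm : ℂ →+* 𝕜) :=
    (RCLike.complexLinearIsometryEquiv hI').symm.continuous
  let _ : Module ℂ E := Module.compHom E (σ.symm : ℂ →+* 𝕜)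
  let _ : Module ℂ F := Module.compHom F (σ.symm : ℂ →+* 𝕜)
  have hE' : ∀ (c : ℂ) (v : E), (σ.symm : ℂ →+* 𝕜) c • v = c • v := fun _ _ => rfl
  have hF' : ∀ (c : ℂ) (v : F), (σ.symm : ℂ →+* 𝕜) c • v = c • v := fun _ _ => rfl
  have hE : ∀ (c : 𝕜) (v : E), (σ : 𝕜 →+* ℂ) c • v = c • v := fun c v => by
    rw [← hE']; simp
  have hF : ∀ (c : 𝕜) (v : F), (σ : 𝕜 →+* ℂ) c • v = c • v := fun c v => by
    rw [← hF']; simp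
  have : ContinuousSMul ℂ E :=
    ⟨(hσ'.comp continuous_fst).smul (continuous_snd : Continuous fun q : ℂ × E => q.2)⟩
  have : ContinuousSMul ℂ F :=
    ⟨(hσ'.comp continuous_fst).smul (continuous_snd : Continuous fun q : ℂ × F => q.2)⟩
  have : PolynormableSpace ℂ F := by
    let _ : Module ℝ F := Module.compHom F (algebraMap ℝ 𝕜)
    have : IsScalarTower ℝ 𝕜 F := isScalarTower_compHom
    have : LocallyConvexSpace ℝ F := locallyConvexSpace_compHom (𝕜 := 𝕜)
    have : IsScalarTower ℝ ℂ F := by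
      refine ⟨fun r c v => ?_⟩
      rw [← hF', ← hF']
      change _ = (algebraMap ℝ 𝕜 r) • (σ.symm : ℂ →+* 𝕜) c • v
      rw [smul_smul]
      congr 1
      rw [Complex.real_smul, map_mul]
      congr 1
      simp [σ, RCLike.complexRingEquiv]
    exact polynormableSpace_of_locallyConvexSpace ℂ F
  constructor
  · exact fun h n => ((h.baseChange hF' hE').ckOn n hU).baseChange hσ hF hE
  · exact fun h =>
      (seriesAnalyticOn_of_ckOn hU fun n => (h n).baseChange hσ' hF' hE').baseChange hF hE

end LocallyConvex

section Complexification

theorem continuous_toComplexification {𝕜 E : Type*} [AddCommGroup E] [TopologicalSpace E] :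
    Continuous (toComplexification 𝕜 : E → Complexification 𝕜 E) :=
  (continuous_id.prodMk continuous_const : Continuous fun x : E => (x, (0 : E)))

variable {𝕜 : Type*} [RCLike 𝕜] {E : Type u} [AddCommGroup E] [Module 𝕜 E]

theorem complexification_smul (z : ℂ) (p : Complexification 𝕜 E) :
    z • p = ((z.re : 𝕜) • p.1 - (z.im : 𝕜) • p.2, (z.re : 𝕜) • p.2 + (z.im : 𝕜) • p.1) := rfl

variable [TopologicalSpace E]

instance [IsTopologicalAddGroup E] : IsTopologicalAddGroup (Complexification 𝕜 E) :=
  inferInstanceAs (IsTopologicalAddGroup (E × E))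

instance [T2Space E] : T2Space (Complexification 𝕜 E) :=
  inferInstanceAs (T2Space (E × E))

instance [IsTopologicalAddGroup E] [ContinuousSMul 𝕜 E] :
    ContinuousSMul ℂ (Complexification 𝕜 E) := by
  refine ⟨?_⟩
  change Continuous fun q : ℂ × (E × E) => (((q.1.re : 𝕜) • q.2.1 - (q.1.im : 𝕜) • q.2.2,
    (q.1.re : 𝕜) • q.2.2 + (q.1.im : 𝕜) • q.2.1) : E × E)
  fun_prop

instance [IsTopologicalAddGroup E] [ContinuousSMul 𝕜 E] [PolynormableSpace 𝕜 E] :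
    PolynormableSpace ℂ (Complexification 𝕜 E) := by
  let _ : Module ℝ E := Module.compHom E (algebraMap ℝ 𝕜)
  have : LocallyConvexSpace ℝ E := locallyConvexSpace_compHom (𝕜 := 𝕜)
  let L : Complexification 𝕜 E →ₗ[ℝ] E × E :=
    { toFun := fun p => p
      map_add' := fun _ _ => rfl
      map_smul' := fun r p => by
        change (r : ℂ) • p = (algebraMap ℝ 𝕜 r • p.1, algebraMap ℝ 𝕜 r • p.2)
        rw [complexification_smul]
        simp
        rfl }
  have hL : IsInducing L := ⟨induced_id.symm⟩
  have : LocallyConvexSpace ℝ (Complexification 𝕜 E) := hL.locallyConvexSpace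
  exact polynormableSpace_of_locallyConvexSpace ℂ _

/-- The complexification of a continuous linear map. -/
noncomputable def complexifyCLM {F : Type v} [AddCommGroup F] [Module 𝕜 F] [TopologicalSpace F]
    (L : E →L[𝕜] F) : Complexification 𝕜 E →L[ℂ] Complexification 𝕜 F where
  toFun p := (L p.1, L p.2)
  map_add' p q := Prod.ext (map_add L p.1 q.1) (map_add L p.2 q.2)
  map_smul' z p := by
    simp only [complexification_smul, map_sub, map_add, map_smul, RingHom.id_apply]
    rfl
  cont := (L.prodMap L).continuous

/-- The complex extension is `C^n` over `ℂ`, hence over `𝕜`, which is `ℝ` here. Composing with the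
inclusion of the real part and the projection to it recovers `f`. -/
theorem RealAnalyticOn.ckOn (hI : (RCLike.I : 𝕜) = 0) [IsTopologicalAddGroup E]
    [ContinuousSMul 𝕜 E] {F : Type v} [AddCommGroup F]
    [Module 𝕜 F] [TopologicalSpace F] [IsTopologicalAddGroup F] [ContinuousSMul 𝕜 F]
    [PolynormableSpace 𝕜 F] [T2Space F] {f : E → F} {U : Set E} (hU : IsOpen U)
    (hf : RealAnalyticOn 𝕜 f U) (n : ℕ) : CkOn 𝕜 n f U := by
  obtain ⟨V, g, hV, hUV, hg, hfg⟩ := hf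
  let τ : 𝕜 →+* ℂ := Complex.ofRealHom.comp (RCLike.realRingEquiv hI : 𝕜 →+* ℝ)
  have hτ : Continuous τ := Complex.continuous_ofReal.comp RCLike.continuous_re
  let _ : Module 𝕜 (Complexification 𝕜 E) := inferInstanceAs (Module 𝕜 (E × E))
  let _ : Module 𝕜 (Complexification 𝕜 F) := inferInstanceAs (Module 𝕜 (F × F))
  have hre : ∀ c : 𝕜, ((RCLike.re c : ℝ) : 𝕜) = c := (RCLike.realRingEquiv hI).symm_apply_apply
  have h1 : CkOn 𝕜 n g V := (hg.ckOn n hV).baseChange (τ := τ) hτ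
    (fun c v => by
      change ((RCLike.re c : ℝ) : ℂ) • v = (c • v.1, c • v.2)
      rw [complexification_smul]
      simp [hre]
      rfl)
    (fun c v => by
      change ((RCLike.re c : ℝ) : ℂ) • v = (c • v.1, c • v.2)
      rw [complexification_smul]
      simp [hre]
      rfl)
  let P : Complexification 𝕜 F →L[𝕜] F := ContinuousLinearMap.fst 𝕜 F F
  let J : E →L[𝕜] Complexification 𝕜 E := ContinuousLinearMap.inl 𝕜 E E
  have h2 : CkOn 𝕜 n (fun x => P (g (J x))) U :=
    ((h1.comp_clm J).clm_comp P).mono hUV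
  exact h2.congr hU fun x hx => congrArg Prod.fst (hfg x hx)

end Complexification

/-! ### Calculus of `C^r`-maps -/

section Cr

variable {𝕜 : Type*} [RCLike 𝕜] {r : WithTop ℕ∞}
  {E : Type u} [AddCommGroup E] [Module 𝕜 E] [TopologicalSpace E]
  {F : Type v} [AddCommGroup F] [Module 𝕜 F] [TopologicalSpace F]

theorem RealAnalyticOn.mono {f : E → F} {U U' : Set E} (hf : RealAnalyticOn 𝕜 f U)
    (h : U' ⊆ U) : RealAnalyticOn 𝕜 f U' := by
  obtain ⟨V, g, hV, hUV, hg, hfg⟩ := hf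
  exact ⟨V, g, hV, fun x hx => hUV x (h hx), hg, fun x hx => hfg x (h hx)⟩

theorem CrOn.mono {f : E → F} {U U' : Set E} (hf : CrOn 𝕜 r f U) (h : U' ⊆ U) :
    CrOn 𝕜 r f U' := by
  refine ⟨fun hr hI => (hf.1 hr hI).mono h, fun hr hI => ?_, fun hr n hn => (hf.2.2 hr n hn).mono h⟩
  exact ⟨(hf.2.1 hr hI).1.mono h, fun x hx => (hf.2.1 hr hI).2 x (h hx)⟩

variable [IsTopologicalAddGroup E] [ContinuousSMul 𝕜 E]
  [IsTopologicalAddGroup F] [ContinuousSMul 𝕜 F] [PolynormableSpace 𝕜 F] [T2Space F]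

theorem CrOn.ckOn {f : E → F} {U : Set E} (hf : CrOn 𝕜 r f U) (hU : IsOpen U) {n : ℕ}
    (hn : (n : WithTop ℕ∞) ≤ r) : CkOn 𝕜 n f U := by
  by_cases hr : r = ω
  · by_cases hI : (RCLike.I : 𝕜) = 0
    · exact (hf.1 hr hI).ckOn hI hU n
    · exact (seriesAnalyticOn_iff_ckOn_of_I_ne_zero hI hU).1 (hf.2.1 hr hI) n
  · exact hf.2.2 hr n hn

/-- `C^r`-maps are real analytic if `r = ω` and `𝕜 = ℝ`, and `C^n` for all `n ≤ r` otherwise. -/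
theorem crOn_iff {f : E → F} {U : Set E} (hU : IsOpen U) : CrOn 𝕜 r f U ↔
    (r = ω → (RCLike.I : 𝕜) = 0 → RealAnalyticOn 𝕜 f U) ∧
      (¬(r = ω ∧ (RCLike.I : 𝕜) = 0) → ∀ n : ℕ, (n : WithTop ℕ∞) ≤ r → CkOn 𝕜 n f U) := by
  refine ⟨fun h => ⟨h.1, fun _ n hn => h.ckOn hU hn⟩, fun h => ⟨h.1, fun hr hI => ?_, fun hr =>
    h.2 fun h' => hr h'.1⟩⟩
  exact (seriesAnalyticOn_iff_ckOn_of_I_ne_zero hI hU).2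
    fun n => h.2 (fun h' => hI h'.2) n (hr ▸ le_top)

theorem CrOn.congr {f g : E → F} {U : Set E} (hf : CrOn 𝕜 r f U) (hU : IsOpen U)
    (hfg : EqOn f g U) : CrOn 𝕜 r g U := by
  rw [crOn_iff hU] at hf ⊢
  refine ⟨fun hr hI => ?_, fun h n hn => (hf.2 h n hn).congr hU hfg⟩
  obtain ⟨V, k, hV, hUV, hk, hfk⟩ := hf.1 hr hI
  exact ⟨V, k, hV, hUV, hk, fun x hx => by rw [hfk x hx, hfg hx]⟩

theorem CrOn.add {f g : E → F} {U : Set E} (hU : IsOpen U) (hf : CrOn 𝕜 r f U)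
    (hg : CrOn 𝕜 r g U) : CrOn 𝕜 r (fun x => f x + g x) U := by
  rw [crOn_iff hU] at hf hg ⊢
  refine ⟨fun hr hI => ?_, fun h n hn => (hf.2 h n hn).add (hg.2 h n hn)⟩
  obtain ⟨V, k, hV, hUV, hk, hfk⟩ := hf.1 hr hI
  obtain ⟨V', k', hV', hUV', hk', hgk⟩ := hg.1 hr hI
  refine ⟨V ∩ V', fun x => k x + k' x, hV.inter hV', fun x hx => ⟨hUV x hx, hUV' x hx⟩,
    seriesAnalyticOn_of_ckOn (hV.inter hV') fun n => ?_, fun x hx => ?_⟩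
  · exact ((hk.ckOn n hV).mono inter_subset_left).add ((hk'.ckOn n hV').mono inter_subset_right)
  · change k _ + k' _ = _
    rw [hfk x hx, hgk x hx]
    exact Prod.ext rfl (add_zero (0 : F))

theorem crOn_clm (L : E →L[𝕜] F) {U : Set E} (hU : IsOpen U) : CrOn 𝕜 r L U := by
  rw [crOn_iff hU]
  refine ⟨fun hr hI => ⟨univ, complexifyCLM L, isOpen_univ, fun _ _ => mem_univ _,
    seriesAnalyticOn_of_ckOn isOpen_univ fun n => ckOn_clm _ n _, fun x _ => ?_⟩,
    fun _ n _ => ckOn_clm L n U⟩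
  exact Prod.ext rfl (map_zero L)

/-- In the real analytic case the complex extensions are composed. Their composite is analytic
because it is `C^n` over `ℂ` for all `n`, so no substitution of power series is needed. -/
theorem CrOn.comp {G : Type w} [AddCommGroup G] [Module 𝕜 G] [TopologicalSpace G]
    [IsTopologicalAddGroup G] [ContinuousSMul 𝕜 G] [PolynormableSpace 𝕜 G] [T2Space G]
    {f : E → F} {g : F → G} {U : Set E} {V : Set F} (hg : CrOn 𝕜 r g V) (hf : CrOn 𝕜 r f U)
    (hU : IsOpen U) (hV : IsOpen V) (hUV : MapsTo f U V) : CrOn 𝕜 r (fun x => g (f x)) U := by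
  rw [crOn_iff hU] at hf ⊢
  rw [crOn_iff hV] at hg
  refine ⟨fun hr hI => ?_, fun h n hn => (hg.2 h n hn).comp (hf.2 h n hn) hV hUV⟩
  obtain ⟨U', k, hU', hUU', hk, hfk⟩ := hf.1 hr hI
  obtain ⟨V', l, hV', hVV', hl, hgl⟩ := hg.1 hr hI
  have hW : IsOpen (U' ∩ k ⁻¹' V') := hk.1.isOpen_inter_preimage hU' hV'
  refine ⟨U' ∩ k ⁻¹' V', fun x => l (k x), hW, fun x hx => ⟨hUU' x hx, ?_⟩,
    seriesAnalyticOn_of_ckOn hW fun n => ?_, fun x hx => ?_⟩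
  · rw [mem_preimage, hfk x hx]
    exact hVV' _ (hUV hx)
  · exact (hl.ckOn n hV').comp ((hk.ckOn n hU').mono inter_subset_left) hV' fun x hx => hx.2
  · change l (k _) = _
    rw [hfk x hx, hgl _ (hUV hx)]

end Cr

/-! ### Inverse function theorem for `C^r`-maps -/

section InverseFunction

variable {𝕜 : Type*} [RCLike 𝕜]

/-- The sup norm on `B × B` is in general not homogeneous over `ℂ`; this is why
`exists_localInverse` asks only for a real norm with a compatible continuous `𝕜`-action. -/
theorem exists_localInverse_complexification {B : Type u} [NormedAddCommGroup B] [NormedSpace 𝕜 B]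
    [CompleteSpace B] {g : Complexification 𝕜 B → Complexification 𝕜 B}
    {V : Set (Complexification 𝕜 B)} (hV : IsOpen V) (hg : ∀ n : ℕ, CkOn ℂ n g V)
    {z₀ : Complexification 𝕜 B} (hz₀ : z₀ ∈ V)
    (hd : HasDifferentialAt ℂ g z₀ (ContinuousLinearMap.id ℂ (Complexification 𝕜 B))) :
    ∃ Ψ : OpenPartialHomeomorph (Complexification 𝕜 B) (Complexification 𝕜 B),
      z₀ ∈ Ψ.source ∧ Ψ.source ⊆ V ∧ (∀ z, Ψ z = g z) ∧
        ∀ n : ℕ, CkOn ℂ n Ψ.symm Ψ.target := by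
  let _ : NormedSpace ℝ B := NormedSpace.restrictScalars ℝ 𝕜 B
  let nr : NormedSpace ℝ (B × B) := inferInstance
  let _ : Module ℂ (B × B) := inferInstanceAs (Module ℂ (Complexification 𝕜 B))
  let _ : Module ℝ (B × B) := nr.toModule
  have : ContinuousSMul ℂ (B × B) := inferInstanceAs (ContinuousSMul ℂ (Complexification 𝕜 B))
  have : PolynormableSpace ℂ (B × B) :=
    inferInstanceAs (PolynormableSpace ℂ (Complexification 𝕜 B))
  have hr : ∀ (r : ℝ) (v : B × B), (r : ℂ) • v = r • v := fun r v => by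
    change (((r : ℂ).re : 𝕜) • v.1 - ((r : ℂ).im : 𝕜) • v.2,
      ((r : ℂ).re : 𝕜) • v.2 + ((r : ℂ).im : 𝕜) • v.1) =
        ((algebraMap ℝ 𝕜 r) • v.1, (algebraMap ℝ 𝕜 r) • v.2)
    simp
  have hst : IsScalarTower ℝ ℂ (B × B) := ⟨fun r c v => by
    rw [← hr, smul_smul, Complex.real_smul]⟩
  obtain ⟨Ψ, h1, h2, h3, h4⟩ := @exists_localInverse ℂ _ (B × B) _ nr _ hst _ _ _ g V hV
    (hg 1) (Or.inl (hg 2)) z₀ hz₀ hd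
  exact ⟨Ψ, h1, h2, h3, fun n => h4 n (hg n)⟩

/-- Along real parameters the differential of `g` is the identity on real vectors, because `g`
extends `f` there. Being `ℂ`-linear, it is the identity on `E + iE`. -/
theorem hasDifferentialAt_id_of_extension {E : Type u} [AddCommGroup E]
    [Module 𝕜 E]
    [TopologicalSpace E] [IsTopologicalAddGroup E] [ContinuousSMul 𝕜 E] [T2Space E]
    [PolynormableSpace 𝕜 E] {f : E → E} {U : Set E} (hU : IsOpen U)
    {g : Complexification 𝕜 E → Complexification 𝕜 E} {V : Set (Complexification 𝕜 E)}
    (hV : IsOpen V) (hg : CkOn ℂ 1 g V)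
    (hfg : ∀ x ∈ U, g (toComplexification 𝕜 x) = toComplexification 𝕜 (f x)) {x₀ : E}
    (hx₀ : x₀ ∈ U) (hx₀' : toComplexification 𝕜 x₀ ∈ V)
    (hd₀ : HasDifferentialAt 𝕜 f x₀ (ContinuousLinearMap.id 𝕜 E)) :
    HasDifferentialAt ℂ g (toComplexification 𝕜 x₀)
      (ContinuousLinearMap.id ℂ (Complexification 𝕜 E)) := by
  obtain ⟨L, hL⟩ := hg.exists_hasDifferentialAt hV hx₀'
  suffices h : L = ContinuousLinearMap.id ℂ (Complexification 𝕜 E) by rwa [← h]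
  have hreal : ∀ y : E, L (toComplexification 𝕜 y) = toComplexification 𝕜 y := by
    intro y
    have h1 := Tendsto.comp (hL (toComplexification 𝕜 y))
      (tendsto_ofReal_nhdsNE_zero (𝕜 := ℂ))
    have h2 := (continuous_toComplexification (𝕜 := 𝕜).tendsto y).comp
      (Tendsto.comp (hd₀ y) (tendsto_ofReal_nhdsNE_zero (𝕜 := 𝕜)))
    refine tendsto_nhds_unique h1 (h2.congr' ?_)
    have h3 : ∀ᶠ t : ℝ in 𝓝[≠] 0, x₀ + (t : 𝕜) • y ∈ U :=
      ((tendsto_add_smul (𝕜 := 𝕜) x₀ y).mono_left nhdsWithin_le_nhds).comp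
        tendsto_ofReal_nhdsNE_zero |>.eventually (hU.mem_nhds hx₀)
    filter_upwards [h3] with t ht
    have e : toComplexification 𝕜 x₀ + ((t : ℝ) : ℂ) • toComplexification 𝕜 y =
        toComplexification 𝕜 (x₀ + (t : 𝕜) • y) := by
      rw [complexification_smul]
      refine Prod.ext ?_ ?_
      · change x₀ + (((t : ℂ).re : 𝕜) • y - ((t : ℂ).im : 𝕜) • (0 : E)) = x₀ + (t : 𝕜) • y
        simp
      · change (0 : E) + (((t : ℂ).re : 𝕜) • (0 : E) + ((t : ℂ).im : 𝕜) • y) = 0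
        simp
    simp only [Function.comp_apply]
    change _ =
      ((t : ℝ) : ℂ)⁻¹ • (g (toComplexification 𝕜 x₀ + (t : ℂ) • toComplexification 𝕜 y) - _)
    rw [e, hfg _ ht, hfg _ hx₀, ← Complex.ofReal_inv, complexification_smul]
    refine Prod.ext ?_ ?_
    · change ((t : ℝ) : 𝕜)⁻¹ • (f (x₀ + (t : 𝕜) • y) - f x₀) =
        (((t⁻¹ : ℝ) : ℂ).re : 𝕜) • (f (x₀ + (t : 𝕜) • y) - f x₀) -
          (((t⁻¹ : ℝ) : ℂ).im : 𝕜) • ((0 : E) - 0)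
      simp
    · change (0 : E) = (((t⁻¹ : ℝ) : ℂ).re : 𝕜) • ((0 : E) - 0) +
          (((t⁻¹ : ℝ) : ℂ).im : 𝕜) • (f (x₀ + (t : 𝕜) • y) - f x₀)
      simp
  ext z
  have hz : z = toComplexification 𝕜 z.1 + Complex.I • toComplexification 𝕜 z.2 := by
    rw [complexification_smul]
    refine Prod.ext ?_ ?_
    · change z.1 = z.1 + ((Complex.I.re : 𝕜) • z.2 - (Complex.I.im : 𝕜) • (0 : E))
      simp
    · change z.2 = 0 + ((Complex.I.re : 𝕜) • (0 : E) + (Complex.I.im : 𝕜) • z.2)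
      simp
  rw [hz, map_add, map_smul, hreal, hreal]
  rfl

theorem CrOn.exists_localInverse_banach {r : WithTop ℕ∞} (hr : 1 ≤ r) {B : Type u}
    [NormedAddCommGroup B] [NormedSpace 𝕜 B] [CompleteSpace B] {f : B → B} {U : Set B}
    (hU : IsOpen U) (hf : CrOn 𝕜 r f U) (hreg : 2 ≤ r ∨ FiniteDimensional 𝕜 B) {x₀ : B}
    (hx₀ : x₀ ∈ U) (hd₀ : HasDifferentialAt 𝕜 f x₀ (ContinuousLinearMap.id 𝕜 B)) :
    ∃ Φ : OpenPartialHomeomorph B B, x₀ ∈ Φ.source ∧ Φ.source ⊆ U ∧ (∀ x, Φ x = f x) ∧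
      CrOn 𝕜 r Φ.symm Φ.target := by
  let _ : NormedSpace ℝ B := NormedSpace.restrictScalars ℝ 𝕜 B
  have : IsScalarTower ℝ 𝕜 B := isScalarTower_compHom
  obtain ⟨Φ, h1, h2, h3, h4⟩ := exists_localInverse hU (hf.ckOn hU (n := 1) (by exact_mod_cast hr))
    (hreg.imp (fun h => hf.ckOn hU (n := 2) (by exact_mod_cast h))
      fun h => by have := h; exact Module.Finite.trans 𝕜 B) hx₀ hd₀
  by_cases hω : r = ω ∧ (RCLike.I : 𝕜) = 0
  · obtain ⟨hω, hI⟩ := hω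
    obtain ⟨V, g, hV, hUV, hg, hfg⟩ := hf.1 hω hI
    have hgk := fun n => hg.ckOn n hV
    obtain ⟨Ψ, k1, k2, k3, k4⟩ := exists_localInverse_complexification hV hgk (hUV _ hx₀)
      (hasDifferentialAt_id_of_extension hU hV (hgk 1) hfg hx₀ (hUV _ hx₀) hd₀)
    have hS : IsOpen (toComplexification 𝕜 ⁻¹' Ψ.source : Set B) :=
      Ψ.open_source.preimage continuous_toComplexification
    -- After this shrinking, real points of the source lie in the domain where `Ψ` is injective, so
    -- `Ψ.symm` extends the local inverse of `f`.
    let Φ' := Φ.restrOpen _ hS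
    have hsrc : Φ'.source = Φ.source ∩ (toComplexification 𝕜 ⁻¹' Ψ.source) :=
      Φ.restrOpen_source _ hS
    refine ⟨Φ', ?_, ?_, h3, ?_⟩
    · rw [hsrc]
      exact ⟨h1, k1⟩
    · rw [hsrc]
      exact inter_subset_left.trans h2
    · rw [crOn_iff Φ'.open_target]
      refine ⟨fun _ _ => ⟨Ψ.target, Ψ.symm, Ψ.open_target, fun y hy => ?_,
        seriesAnalyticOn_of_ckOn Ψ.open_target k4, fun y hy => ?_⟩, fun h => absurd ⟨hω, hI⟩ h⟩
      all_goals
        have hx := Φ'.map_target hy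
        have hy' : f (Φ'.symm y) = y := (h3 _).symm.trans (Φ'.right_inv hy)
        rw [hsrc] at hx
        have e : Ψ (toComplexification 𝕜 (Φ'.symm y)) = toComplexification 𝕜 y := by
          rw [k3, hfg _ (h2 hx.1), hy']
      · rw [← e]
        exact Ψ.map_source hx.2
      · rw [← e]
        exact Ψ.left_inv hx.2
  · refine ⟨Φ, h1, h2, h3, (crOn_iff Φ.open_target).2 ⟨fun hr hI => absurd ⟨hr, hI⟩ hω,
      fun _ n hn => h4 n (hf.ckOn hU hn)⟩⟩

/-- Inverse function theorem for `C^r`-maps. -/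
theorem CrOn.exists_localInverse {r : WithTop ℕ∞} (hr : 1 ≤ r) {E : Type u} [AddCommGroup E]
    [Module 𝕜 E] [TopologicalSpace E] [IsTopologicalAddGroup E] [ContinuousSMul 𝕜 E] [T2Space E]
    [PolynormableSpace 𝕜 E] {B : Type w}
    [NormedAddCommGroup B] [NormedSpace 𝕜 B] [CompleteSpace B] (ε : E ≃L[𝕜] B) {f : E → E}
    {U : Set E}
    (hU : IsOpen U) (hf : CrOn 𝕜 r f U) (hreg : 2 ≤ r ∨ FiniteDimensional 𝕜 B) {x₀ : E}
    (hx₀ : x₀ ∈ U) (hd₀ : HasDifferentialAt 𝕜 f x₀ (ContinuousLinearMap.id 𝕜 E)) :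
    ∃ Φ : OpenPartialHomeomorph E E, x₀ ∈ Φ.source ∧ Φ.source ⊆ U ∧ (∀ x, Φ x = f x) ∧
      CrOn 𝕜 r Φ.symm Φ.target := by
  have hU' : IsOpen (ε.symm ⁻¹' U) := hU.preimage ε.symm.continuous
  have hf1 : CrOn 𝕜 r (fun b => f (ε.symm b)) (ε.symm ⁻¹' U) :=
    hf.comp (crOn_clm (ε.symm : B →L[𝕜] E) hU') hU' hU fun _ h => h
  have hf' : CrOn 𝕜 r (fun b => ε (f (ε.symm b))) (ε.symm ⁻¹' U) :=
    (crOn_clm (ε : E →L[𝕜] B) isOpen_univ).comp hf1 hU' isOpen_univ fun _ _ => mem_univ _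
  obtain ⟨Φ, h1, h2, h3, h4⟩ := hf'.exists_localInverse_banach hr hU' hreg
    (x₀ := ε x₀) (by simpa using hx₀) fun y => by
      have := (hd₀ (ε.symm y)).clm_comp (ε : E →L[𝕜] B)
      simpa [HasDirDerivAt] using this
  refine ⟨(ε.toHomeomorph.transOpenPartialHomeomorph Φ).transHomeomorph ε.symm.toHomeomorph,
    h1, fun x hx => by simpa using h2 hx, fun x => ?_, ?_⟩
  · change ε.symm (Φ (ε x)) = f x
    simp [h3]
  · change CrOn 𝕜 r (fun y => ε.symm (Φ.symm (ε y))) (ε ⁻¹' Φ.target)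
    have hT : IsOpen (ε ⁻¹' Φ.target) := Φ.open_target.preimage ε.continuous
    have h5 : CrOn 𝕜 r (fun y => Φ.symm (ε y)) (ε ⁻¹' Φ.target) :=
      h4.comp (crOn_clm (ε : E →L[𝕜] B) hT) hT Φ.open_target fun _ h => h
    exact (crOn_clm (ε.symm : B →L[𝕜] E) isOpen_univ).comp h5 hT isOpen_univ fun _ _ => mem_univ _

end InverseFunction

/-! ### Left inverses and local `C^1`-regularity -/

section Complemented

variable {R E F : Type*} [Ring R] [AddCommGroup E] [Module R E] [TopologicalSpace E]
  [AddCommGroup F] [Module R F] [TopologicalSpace F]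

/-- `P` is the projection onto the range followed by the inverse of `j`; it is continuous because
`j` is inducing and `j ∘ P` is the projection. -/
theorem exists_leftInverse_of_closedComplemented {j : E →ₗ[R] F} (hj : IsEmbedding j)
    (hc : (LinearMap.range j).ClosedComplemented) : ∃ P : F →L[R] E, ∀ x, P (j x) = x := by
  obtain ⟨q, hq⟩ := hc
  let P : F →ₗ[R] E := (LinearEquiv.ofInjective j hj.injective).symm.toLinearMap ∘ₗ q.toLinearMap
  have hjP : ∀ y, j (P y) = q y := fun y =>
    congrArg Subtype.val ((LinearEquiv.ofInjective j hj.injective).apply_symm_apply (q y))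
  refine ⟨⟨P, ?_⟩, fun x => hj.injective ?_⟩
  · change Continuous P
    rw [hj.isInducing.continuous_iff]
    exact (continuous_subtype_val.comp q.continuous).congr fun y => (hjP y).symm
  · exact (hjP (j x)).trans (congrArg Subtype.val (hq ⟨j x, LinearMap.mem_range_self j x⟩))

end Complemented

section C1At

variable (𝕜 : Type*) [RCLike 𝕜] {E : Type u} [AddCommGroup E] [Module 𝕜 E] [TopologicalSpace E]
  {F : Type v} [AddCommGroup F] [Module 𝕜 F] [TopologicalSpace F]

/-- `f` is `C^1` on some open neighbourhood of `x`. -/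
def C1At (f : E → F) (x : E) : Prop :=
  ∃ U : Set E, IsOpen U ∧ x ∈ U ∧ CkOn 𝕜 1 f U

variable {𝕜} [IsTopologicalAddGroup E] [ContinuousSMul 𝕜 E]

theorem C1At.congr {f g : E → F} {x : E} (hf : C1At 𝕜 f x) (hfg : f =ᶠ[𝓝 x] g) :
    C1At 𝕜 g x := by
  obtain ⟨U, hU, hx, hf⟩ := hf
  obtain ⟨V, hVfg, hV, hxV⟩ := mem_nhds_iff.1 hfg
  exact ⟨U ∩ V, hU.inter hV, ⟨hx, hxV⟩,
    (hf.mono inter_subset_left).congr (hU.inter hV) fun z hz => hVfg hz.2⟩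

variable [IsTopologicalAddGroup F] [ContinuousSMul 𝕜 F] [PolynormableSpace 𝕜 F]

theorem C1At.comp {D : Type w} [AddCommGroup D] [Module 𝕜 D] [TopologicalSpace D]
    {f : D → E} {g : E → F} {x : D} (hg : C1At 𝕜 g (f x))
    (hf : C1At 𝕜 f x) : C1At 𝕜 (fun z => g (f z)) x := by
  obtain ⟨V, hV, hx', hg⟩ := hg
  obtain ⟨U, hU, hx, hf⟩ := hf
  exact ⟨U ∩ f ⁻¹' V, hf.continuousOn.isOpen_inter_preimage hU hV, ⟨hx, hx'⟩,
    hg.comp (hf.mono inter_subset_left) hV fun z hz => hz.2⟩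

variable [T2Space F]

theorem C1At.exists_hasDifferentialAt {f : E → F} {x : E} (hf : C1At 𝕜 f x) :
    ∃ L : E →L[𝕜] F, HasDifferentialAt 𝕜 f x L := by
  obtain ⟨U, hU, hx, hf⟩ := hf
  exact hf.exists_hasDifferentialAt hU hx

theorem C1At.hasDirDerivAt_comp {D : Type w} [AddCommGroup D] [Module 𝕜 D]
    {f : D → E} {g : E → F} {x y : D} {w : E} (hg : C1At 𝕜 g (f x)) {L : E →L[𝕜] F}
    (hL : HasDifferentialAt 𝕜 g (f x) L) (hf : HasDirDerivAt 𝕜 f x y w) :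
    HasDirDerivAt 𝕜 (fun z => g (f z)) x y (L w) := by
  obtain ⟨V, hV, hx', hg⟩ := hg
  exact hf.comp_differential hV hg hx' hL

end C1At

theorem CrOn.c1At {𝕜 : Type*} [RCLike 𝕜] {r : WithTop ℕ∞} (hr : 1 ≤ r)
    {E : Type u} [AddCommGroup E] [Module 𝕜 E] [TopologicalSpace E] [IsTopologicalAddGroup E]
    [ContinuousSMul 𝕜 E] {F : Type v} [AddCommGroup F] [Module 𝕜 F] [TopologicalSpace F]
    [IsTopologicalAddGroup F] [ContinuousSMul 𝕜 F] [PolynormableSpace 𝕜 F] [T2Space F]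
    {f : E → F} {U : Set E} (hf : CrOn 𝕜 r f U) (hU : IsOpen U) {x : E} (hx : x ∈ U) :
    C1At 𝕜 f x :=
  ⟨U, hU, hx, hf.ckOn hU (by exact_mod_cast hr)⟩

/-! ### Charts and tangent spaces -/

section Charts

variable {𝕜 : Type*} [RCLike 𝕜] {r : WithTop ℕ∞}
  {E : Type u} [AddCommGroup E] [Module 𝕜 E] [TopologicalSpace E]
  [IsTopologicalAddGroup E] [ContinuousSMul 𝕜 E]
  {M : Type*} [TopologicalSpace M] [ChartedSpace E M]

theorem IsCrMap.c1At (hr : 1 ≤ r) {F : Type v} [AddCommGroup F] [Module 𝕜 F] [TopologicalSpace F]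
    [IsTopologicalAddGroup F] [ContinuousSMul 𝕜 F] [PolynormableSpace 𝕜 F] [T2Space F]
    {N : Type*} [TopologicalSpace N] [ChartedSpace F N] {f : M → N}
    (hf : IsCrMap 𝕜 r (E := E) (F := F) f) {φ : OpenPartialHomeomorph M E}
    {ψ : OpenPartialHomeomorph N F} (hφ : IsChart 𝕜 r φ)
    (hψ : IsChart 𝕜 r ψ) {x : M} (hxφ : x ∈ φ.source) (hxψ : f x ∈ ψ.source) :
    C1At 𝕜 (fun u => ψ (f (φ.symm u))) (φ x) := by
  refine (hf.2 φ ψ hφ hψ).c1At hr ?_ ⟨φ.map_source hxφ, ?_⟩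
  · exact φ.symm.isOpen_inter_preimage (ψ.open_source.preimage hf.1)
  · simpa [φ.left_inv hxφ] using hxψ

variable [PolynormableSpace 𝕜 E] [T2Space E]

/-- `IsChart` compares a chart only with members of the given atlas, so two arbitrary charts are
compared through an atlas chart `e` around `x`. -/
theorem c1At_transition (hr : 1 ≤ r) {φ ψ : OpenPartialHomeomorph M E} (hφ : IsChart 𝕜 r φ)
    (hψ : IsChart 𝕜 r ψ) {x : M} (hxφ : x ∈ φ.source) (hxψ : x ∈ ψ.source) :
    C1At 𝕜 (fun u => ψ (φ.symm u)) (φ x) := by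
  let e := chartAt E x
  have he : e ∈ atlas E M := chart_mem_atlas E x
  have hxe : x ∈ e.source := mem_chart_source E x
  have hx : φ.symm (φ x) = x := φ.left_inv hxφ
  have h1 : C1At 𝕜 (fun u => e (φ.symm u)) (φ x) :=
    (hφ e he).1.c1At hr (φ.symm.trans e).open_source (by simp [hx, hxφ, hxe])
  have h2 : C1At 𝕜 (fun u => ψ (e.symm u)) (e (φ.symm (φ x))) :=
    (hψ e he).2.c1At hr (e.symm.trans ψ).open_source (by simp [hx, hxe, hxψ])
  refine (C1At.comp (f := fun u => e (φ.symm u)) (g := fun z => ψ (e.symm z)) h2 h1).congr ?_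
  filter_upwards [(φ.continuousAt_symm (φ.map_source hxφ)).preimage_mem_nhds
    (e.open_source.mem_nhds (by rwa [hx]))] with u hu
  rw [e.left_inv hu]

theorem IsChart.trans {φ : OpenPartialHomeomorph M E} (hφ : IsChart 𝕜 r φ)
    {Φ : OpenPartialHomeomorph E E} (h : CrOn 𝕜 r Φ Φ.source) (h' : CrOn 𝕜 r Φ.symm Φ.target) :
    IsChart 𝕜 r (φ.trans Φ) := by
  intro e he
  constructor
  · have ho := ((φ.trans Φ).symm.trans e).open_source
    refine (hφ e he).1.comp (h'.mono ?_) ho (φ.symm.trans e).open_source ?_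
    · intro u hu
      simp only [OpenPartialHomeomorph.trans_source, OpenPartialHomeomorph.symm_source,
        OpenPartialHomeomorph.trans_target] at hu
      exact hu.1.1
    · intro u hu
      simpa [and_assoc] using And.intro hu.1.2 hu.2
  · have ho := (e.symm.trans (φ.trans Φ)).open_source
    refine h.comp ((hφ e he).2.mono ?_) ho Φ.open_source ?_
    · intro u hu
      simp only [OpenPartialHomeomorph.trans_source, mem_inter_iff, mem_preimage] at hu ⊢
      exact ⟨hu.1, hu.2.1⟩
    · intro u hu
      simp only [OpenPartialHomeomorph.trans_source, mem_inter_iff, mem_preimage] at hu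
      exact hu.2.2

variable {x : M}

theorem exists_transitionDiff (hr : 1 ≤ r) (φ ψ : ChartsAt 𝕜 r E x) :
    ∃ L : E →L[𝕜] E, HasDifferentialAt 𝕜 (fun u => ψ.1 (φ.1.symm u)) (φ.1 x) L :=
  (c1At_transition hr φ.2.1 ψ.2.1 φ.2.2 ψ.2.2).exists_hasDifferentialAt

/-- The differential of a change of charts. -/
noncomputable def transitionDiff (hr : 1 ≤ r) (φ ψ : ChartsAt 𝕜 r E x) : E →L[𝕜] E :=
  (exists_transitionDiff hr φ ψ).choose

theorem hasDifferentialAt_transitionDiff (hr : 1 ≤ r) (φ ψ : ChartsAt 𝕜 r E x) :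
    HasDifferentialAt 𝕜 (fun u => ψ.1 (φ.1.symm u)) (φ.1 x) (transitionDiff hr φ ψ) :=
  (exists_transitionDiff hr φ ψ).choose_spec

theorem transitionDiff_self (hr : 1 ≤ r) (φ : ChartsAt 𝕜 r E x) (v : E) :
    transitionDiff hr φ φ v = v := by
  refine (hasDifferentialAt_transitionDiff hr φ φ v).unique ?_
  refine (hasDirDerivAt_linearMap LinearMap.id (φ.1 x) v).congr ?_
  filter_upwards [φ.1.open_target.mem_nhds (φ.1.map_source φ.2.2)] with u hu
  exact (φ.1.right_inv hu).symm

theorem transitionDiff_comp (hr : 1 ≤ r) (φ ψ χ : ChartsAt 𝕜 r E x) (v : E) :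
    transitionDiff hr ψ χ (transitionDiff hr φ ψ v) = transitionDiff hr φ χ v := by
  have hx : φ.1.symm (φ.1 x) = x := φ.1.left_inv φ.2.2
  refine HasDirDerivAt.unique (𝕜 := 𝕜) ?_ (hasDifferentialAt_transitionDiff hr φ χ v)
  have h1 := c1At_transition hr ψ.2.1 χ.2.1 ψ.2.2 χ.2.2
  have h2 := hasDifferentialAt_transitionDiff hr ψ χ
  have e : ψ.1 x = ψ.1 (φ.1.symm (φ.1 x)) := by rw [hx]
  rw [e] at h1 h2
  refine (h1.hasDirDerivAt_comp (f := fun u => ψ.1 (φ.1.symm u)) h2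
    (hasDifferentialAt_transitionDiff hr φ ψ v)).congr ?_
  filter_upwards [(φ.1.continuousAt_symm (φ.1.map_source φ.2.2)).preimage_mem_nhds
    (ψ.1.open_source.mem_nhds (by rw [hx]; exact ψ.2.2))] with u hu
  rw [ψ.1.left_inv hu]

/-- The component in a chart identifies the tangent space with the modelling space. -/
noncomputable def tangentEquiv (hr : 1 ≤ r) (φ : ChartsAt 𝕜 r E x) :
    tangentSpace 𝕜 r E x ≃L[𝕜] E where
  toFun v := v.1 φ
  map_add' _ _ := rfl
  map_smul' _ _ := rfl
  invFun w := ⟨fun ψ => transitionDiff hr φ ψ w, fun ψ χ L hL => by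
    change transitionDiff hr φ χ w = L (transitionDiff hr φ ψ w)
    rw [← transitionDiff_comp hr φ ψ χ]
    exact (hasDifferentialAt_transitionDiff hr ψ χ _).unique (hL _)⟩
  left_inv v := Subtype.ext (funext fun ψ =>
    (v.2 φ ψ _ (hasDifferentialAt_transitionDiff hr φ ψ)).symm)
  right_inv w := transitionDiff_self hr φ w
  continuous_toFun := (continuous_apply φ).comp continuous_subtype_val
  continuous_invFun := Continuous.subtype_mk
    (continuous_pi fun ψ => (transitionDiff hr φ ψ).continuous) _

theorem tangentSpace_apply_eq (hr : 1 ≤ r) (φ ψ : ChartsAt 𝕜 r E x) (v : tangentSpace 𝕜 r E x) :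
    v.1 ψ = transitionDiff hr φ ψ (v.1 φ) :=
  v.2 φ ψ _ (hasDifferentialAt_transitionDiff hr φ ψ)

end Charts

/-! ### Immersions and naive immersions -/

section Maps

variable {𝕜 : Type*} [RCLike 𝕜] {r : WithTop ℕ∞}
  {E : Type u} [AddCommGroup E] [Module 𝕜 E] [TopologicalSpace E]
  [IsTopologicalAddGroup E] [ContinuousSMul 𝕜 E] [PolynormableSpace 𝕜 E] [T2Space E]
  {F : Type v} [AddCommGroup F] [Module 𝕜 F] [TopologicalSpace F]
  [IsTopologicalAddGroup F] [ContinuousSMul 𝕜 F] [PolynormableSpace 𝕜 F] [T2Space F]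
  {M : Type*} [TopologicalSpace M] [ChartedSpace E M]
  {N : Type*} [TopologicalSpace N] [ChartedSpace F N] {f : M → N}

/-- Whether a tangent vector is mapped to another one can be tested in a single pair of charts. -/
theorem IsCrMap.hasDirDerivAt_of_charts (hr : 1 ≤ r) (hf : IsCrMap 𝕜 r (E := E) (F := F) f) {x : M}
    (φ φ' : ChartsAt 𝕜 r E x) (ψ ψ' : ChartsAt 𝕜 r F (f x)) (v : tangentSpace 𝕜 r E x)
    (w : tangentSpace 𝕜 r F (f x))
    (h : HasDirDerivAt 𝕜 (fun u => ψ.1 (f (φ.1.symm u))) (φ.1 x) (v.1 φ) (w.1 ψ)) :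
    HasDirDerivAt 𝕜 (fun u => ψ'.1 (f (φ'.1.symm u))) (φ'.1 x) (v.1 φ') (w.1 ψ') := by
  have hx : φ'.1.symm (φ'.1 x) = x := φ'.1.left_inv φ'.2.2
  have hxφ : φ.1.symm (φ.1 x) = x := φ.1.left_inv φ.2.2
  have h1 := hasDifferentialAt_transitionDiff hr φ' φ (v.1 φ')
  rw [← tangentSpace_apply_eq hr φ' φ v] at h1
  have h2 := hf.c1At hr φ.2.1 ψ.2.1 φ.2.2 ψ.2.2
  obtain ⟨L, hL⟩ := h2.exists_hasDifferentialAt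
  have hLv : L (v.1 φ) = w.1 ψ := (hL _).unique h
  have e : φ.1 x = φ.1 (φ'.1.symm (φ'.1 x)) := by rw [hx]
  have h2' : C1At 𝕜 (fun u => ψ.1 (f (φ.1.symm u))) (φ.1 (φ'.1.symm (φ'.1 x))) := e ▸ h2
  have hL' : HasDifferentialAt 𝕜 (fun u => ψ.1 (f (φ.1.symm u))) (φ.1 (φ'.1.symm (φ'.1 x))) L :=
    e ▸ hL
  have h3 := h2'.hasDirDerivAt_comp (f := fun u => φ.1 (φ'.1.symm u)) hL' h1
  rw [hLv] at h3
  have h4 := c1At_transition hr ψ.2.1 ψ'.2.1 ψ.2.2 ψ'.2.2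
  have h5 := hasDifferentialAt_transitionDiff hr ψ ψ'
  have e2 : ψ.1 (f x) = ψ.1 (f (φ.1.symm (φ.1 (φ'.1.symm (φ'.1 x))))) := by rw [hx, hxφ]
  rw [e2] at h4 h5
  have h6 := h4.hasDirDerivAt_comp (f := fun u => ψ.1 (f (φ.1.symm (φ.1 (φ'.1.symm u))))) h5 h3
  rw [← tangentSpace_apply_eq hr ψ ψ' w] at h6
  refine h6.congr ?_
  have hc := φ'.1.continuousAt_symm (φ'.1.map_source φ'.2.2)
  filter_upwards [hc.preimage_mem_nhds (φ.1.open_source.mem_nhds (by rw [hx]; exact φ.2.2)),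
    hc.preimage_mem_nhds ((ψ.1.open_source.preimage hf.1).mem_nhds (by
      rw [hx]; exact ψ.2.2))] with u hu hu'
  rw [φ.1.left_inv hu, ψ.1.left_inv hu']

/-- In the adapted charts the tangent map is `j`. A continuous left inverse of `j` transports to one
of `T`, and this gives both the embedding and the complement of the range. -/
theorem IsCrImmersion.isNaiveImmersion (hr : 1 ≤ r) (hf : IsCrMap 𝕜 r (E := E) (F := F) f)
    (h : IsCrImmersion 𝕜 r (E := E) (F := F) f) : IsNaiveImmersion 𝕜 r (E := E) (F := F) f := by
  intro x
  obtain ⟨φ, ψ, j, hφ, hψ, hxφ, hxψ, -, hj, hjc, hfj⟩ := h x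
  obtain ⟨P, hP⟩ := exists_leftInverse_of_closedComplemented hj hjc
  let j' : E →L[𝕜] F := ⟨j, hj.continuous⟩
  let φ' : ChartsAt 𝕜 r E x := ⟨φ, hφ, hxφ⟩
  let ψ' : ChartsAt 𝕜 r F (f x) := ⟨ψ, hψ, hxψ⟩
  let S := tangentEquiv hr φ'
  let S' := tangentEquiv hr ψ'
  let T : tangentSpace 𝕜 r E x →L[𝕜] tangentSpace 𝕜 r F (f x) :=
    (S'.symm : F →L[𝕜] _).comp (j'.comp (S : _ →L[𝕜] E))
  let Q : tangentSpace 𝕜 r F (f x) →L[𝕜] tangentSpace 𝕜 r E x :=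
    (S.symm : E →L[𝕜] _).comp (P.comp (S' : _ →L[𝕜] F))
  have hQT : Function.LeftInverse Q T := fun v => by
    change S.symm (P (S' (S'.symm (j (S v))))) = v
    rw [S'.apply_symm_apply, hP, S.symm_apply_apply]
  refine ⟨T, fun χ ξ v => ?_, hQT.isEmbedding Q.continuous T.continuous,
    T.closedComplemented_range_of_leftInverse Q hQT⟩
  refine hf.hasDirDerivAt_of_charts hr φ' χ ψ' ξ v (T v) ?_
  have e : (T v).1 ψ' = j (v.1 φ') := S'.apply_symm_apply (j (S v))
  rw [e]
  refine (hasDirDerivAt_linearMap j (φ x) (v.1 φ')).congr ?_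
  filter_upwards [φ.open_target.mem_nhds (φ.map_source hxφ)] with u hu
  exact (hfj u hu).symm

/-- The shear `y ↦ y + h (P y)` for a map `h` with values in the kernel of `P`. -/
def shear (P : F →L[𝕜] E) {h : E → F} {V : Set E} (hV : IsOpen V) (hc : ContinuousOn h V)
    (hP : ∀ u ∈ V, P (h u) = 0) : OpenPartialHomeomorph F F where
  toFun y := y + h (P y)
  invFun y := y + -h (P y)
  source := P ⁻¹' V
  target := P ⁻¹' V
  map_source' y hy := by
    have : P (y + h (P y)) = P y := by rw [map_add, hP _ hy, add_zero]
    rwa [mem_preimage, this]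
  map_target' y hy := by
    have : P (y + -h (P y)) = P y := by rw [map_add, map_neg, hP _ hy, neg_zero, add_zero]
    rwa [mem_preimage, this]
  left_inv' y hy := by
    have : P (y + h (P y)) = P y := by rw [map_add, hP _ hy, add_zero]
    rw [this, add_neg_cancel_right]
  right_inv' y hy := by
    have : P (y + -h (P y)) = P y := by rw [map_add, map_neg, hP _ hy, neg_zero, add_zero]
    rw [this, neg_add_cancel_right]
  open_source := hV.preimage P.continuous
  open_target := hV.preimage P.continuous
  continuousOn_toFun := continuousOn_id.add (hc.comp P.continuous.continuousOn fun _ h => h)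
  continuousOn_invFun := continuousOn_id.add (hc.comp P.continuous.continuousOn fun _ h => h).neg

theorem CrOn.shear {h : E → F} {V : Set E} (hh : CrOn 𝕜 r h V) (hV : IsOpen V) (P : F →L[𝕜] E) :
    CrOn 𝕜 r (fun y => y + h (P y)) (P ⁻¹' V) := by
  have ho : IsOpen (P ⁻¹' V) := hV.preimage P.continuous
  exact (crOn_clm (ContinuousLinearMap.id 𝕜 F) ho).add ho
    (hh.comp (crOn_clm P ho) ho hV fun _ h => h)

theorem IsNaiveImmersion.isCrImmersion (hr : 1 ≤ r) (hM : IsCrManifold 𝕜 r E M)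
    (hN : IsCrManifold 𝕜 r F N) (hf : IsCrMap 𝕜 r (E := E) (F := F) f)
    {B : Type w} [NormedAddCommGroup B] [NormedSpace 𝕜 B] [CompleteSpace B] (ε : E ≃L[𝕜] B)
    (hreg : 2 ≤ r ∨ FiniteDimensional 𝕜 B)
    (h : IsNaiveImmersion 𝕜 r (E := E) (F := F) f) : IsCrImmersion 𝕜 r (E := E) (F := F) f := by
  intro x
  obtain ⟨T, hT, hTe, hTc⟩ := h x
  obtain ⟨Q, hQ⟩ := exists_leftInverse_of_closedComplemented
    (j := (T : tangentSpace 𝕜 r E x →ₗ[𝕜] tangentSpace 𝕜 r F (f x))) hTe hTc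
  have hφ : IsChart 𝕜 r (chartAt E x) := hM _ (chart_mem_atlas E x)
  have hψ : IsChart 𝕜 r (chartAt F (f x)) := hN _ (chart_mem_atlas F (f x))
  have hxφ : x ∈ (chartAt E x).source := mem_chart_source E x
  have hxψ : f x ∈ (chartAt F (f x)).source := mem_chart_source F (f x)
  generalize chartAt E x = φ at hφ hxφ
  generalize chartAt F (f x) = ψ at hψ hxψ
  let φ' : ChartsAt 𝕜 r E x := ⟨φ, hφ, hxφ⟩
  let ψ' : ChartsAt 𝕜 r F (f x) := ⟨ψ, hψ, hxψ⟩
  let S := tangentEquiv hr φ'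
  let S' := tangentEquiv hr ψ'
  let j : E →L[𝕜] F := (S' : _ →L[𝕜] F).comp (T.comp (S.symm : E →L[𝕜] _))
  let P : F →L[𝕜] E := (S : _ →L[𝕜] E).comp (Q.comp (S'.symm : F →L[𝕜] _))
  have hPj : Function.LeftInverse P j := fun v => by
    change S (Q (S'.symm (S' (T (S.symm v))))) = v
    rw [S'.symm_apply_apply]
    exact (congrArg S (hQ _)).trans (S.apply_symm_apply v)
  let fl : E → F := fun u => ψ (f (φ.symm u))
  let U : Set E := φ.target ∩ φ.symm ⁻¹' (f ⁻¹' ψ.source)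
  have hU : IsOpen U := φ.symm.isOpen_inter_preimage (ψ.open_source.preimage hf.1)
  have hfl : CrOn 𝕜 r fl U := hf.2 φ ψ hφ hψ
  have hxU : φ x ∈ U := ⟨φ.map_source hxφ, by simpa [φ.left_inv hxφ] using hxψ⟩
  have hdf : ∀ v, HasDirDerivAt 𝕜 fl (φ x) v (j v) := fun v => by
    have := hT φ' ψ' (S.symm v)
    rwa [show (S.symm v).1 φ' = v from S.apply_symm_apply v] at this
  -- The differential of `P ∘ fl` at `φ x` is `P ∘ j = id`, so the inverse function theorem applies
  -- within `E`.
  have hp : CrOn 𝕜 r (fun u => P (fl u)) U :=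
    (crOn_clm P isOpen_univ).comp hfl hU isOpen_univ fun _ _ => mem_univ _
  obtain ⟨Φ, hxΦ, hΦU, hΦ, hΦs⟩ := hp.exists_localInverse hr ε hU hreg hxU fun v => by
    have := (hdf v).clm_comp P
    rwa [hPj v] at this
  have hΦc : CrOn 𝕜 r Φ Φ.source := (hp.mono hΦU).congr Φ.open_source fun u _ => (hΦ u).symm
  have hUs : ∀ u ∈ Φ.target, Φ.symm u ∈ U := fun u hu => hΦU (Φ.map_target hu)
  have hPfl : ∀ u ∈ Φ.target, P (fl (Φ.symm u)) = u := fun u hu =>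
    (hΦ _).symm.trans (Φ.right_inv hu)
  have hflg : CrOn 𝕜 r (fun u => fl (Φ.symm u)) Φ.target := hfl.comp hΦs Φ.open_target hU hUs
  have hneg : ∀ k : E → F, CrOn 𝕜 r k Φ.target → CrOn 𝕜 r (fun u => -k u) Φ.target := fun k hk =>
    (crOn_clm (-ContinuousLinearMap.id 𝕜 F) isOpen_univ).comp hk Φ.open_target isOpen_univ
      fun _ _ => mem_univ _
  have hk : CrOn 𝕜 r (fun u => j u + -fl (Φ.symm u)) Φ.target :=
    (crOn_clm j Φ.open_target).add Φ.open_target (hneg _ hflg)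
  -- Both `j` and `fl ∘ Φ.symm` are sections of `P` over `Φ.target`, so their difference lies in
  -- `ker P`, as `shear` requires.
  have hkP : ∀ u ∈ Φ.target, P (j u + -fl (Φ.symm u)) = 0 := fun u hu => by
    rw [map_add, map_neg, hPj, hPfl u hu, add_neg_cancel]
  let A := shear P Φ.open_target (hk.ckOn Φ.open_target (n := 0) (by simp)) hkP
  have hA : ∀ y, A y = y + (j (P y) + -fl (Φ.symm (P y))) := fun _ => rfl
  refine ⟨φ.trans Φ, ψ.trans A, (j : E →ₗ[𝕜] F), hφ.trans hΦc hΦs,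
    hψ.trans (hk.shear Φ.open_target P) ((hneg _ hk).shear Φ.open_target P), ?_, ?_, ?_,
    hPj.isEmbedding P.continuous j.continuous, j.closedComplemented_range_of_leftInverse P hPj, ?_⟩
  · exact ⟨hxφ, hxΦ⟩
  · refine ⟨hxψ, ?_⟩
    change P (ψ (f x)) ∈ Φ.target
    have := Φ.map_source hxΦ
    rw [hΦ] at this
    simpa [fl, φ.left_inv hxφ] using this
  · intro z hz
    have hz1 : z ∈ φ.source := hz.1
    have hz2 : φ z ∈ Φ.source := hz.2
    have hzU := (hΦU hz2).2
    simp only [mem_preimage, φ.left_inv hz1] at hzU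
    refine ⟨hzU, ?_⟩
    change P (ψ (f z)) ∈ Φ.target
    have := Φ.map_source hz2
    rw [hΦ] at this
    simpa [fl, φ.left_inv hz1] using this
  · intro u hu
    have hu1 : u ∈ Φ.target := hu.1
    change A (fl (Φ.symm u)) = j u
    -- With `g = fl ∘ Φ.symm` the shear sends `g u` to `g u + (j u - g u)`.
    rw [hA, hPfl u hu1]
    abel

/-- Naive immersions of Banach manifolds, for `r ≥ 2`, and of finite-dimensional manifolds are
immersions. -/
theorem isCrImmersion_iff_isNaiveImmersion (hr : 1 ≤ r) (hM : IsCrManifold 𝕜 r E M)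
    (hN : IsCrManifold 𝕜 r F N) (hf : IsCrMap 𝕜 r (E := E) (F := F) f)
    (h : (IsBanach 𝕜 E ∧ 2 ≤ r) ∨ FiniteDimensional 𝕜 E) :
    IsCrImmersion 𝕜 r (E := E) (F := F) f ↔ IsNaiveImmersion 𝕜 r (E := E) (F := F) f := by
  refine ⟨fun hi => hi.isNaiveImmersion hr hf, fun hn => ?_⟩
  rcases h with ⟨⟨B, _, _, _, ⟨ε⟩⟩, h2⟩ | hfin
  · exact hn.isCrImmersion hr hM hN hf ε (Or.inl h2)
  -- A finite-dimensional Hausdorff topological vector space is isomorphic to some `𝕜^n`, which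
  -- supplies the complete norm.
  · have ε : E ≃L[𝕜] (Fin (Module.finrank 𝕜 E) → 𝕜) :=
      ContinuousLinearEquiv.ofFinrankEq (by simp)
    exact hn.isCrImmersion hr hM hN hf ε (Or.inr inferInstance)

end Maps

end LCCalculus

theorem theoremH :
    -- the real case, `r ∈ {1, 2, …} ∪ {∞, ω}`
    (∀ (r : WithTop ℕ∞) (_ : 1 ≤ r)
      (E : Type*) [AddCommGroup E] [Module ℝ E] [TopologicalSpace E] [IsTopologicalAddGroup E]
      [ContinuousSMul ℝ E] [LocallyConvexSpace ℝ E] [T2Space E]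
      (F : Type*) [AddCommGroup F] [Module ℝ F] [TopologicalSpace F] [IsTopologicalAddGroup F]
      [ContinuousSMul ℝ F] [LocallyConvexSpace ℝ F] [T2Space F]
      (M : Type*) [TopologicalSpace M] [T2Space M] [ChartedSpace E M]
      (_ : LCCalculus.IsCrManifold ℝ r E M)
      (N : Type*) [TopologicalSpace N] [T2Space N] [ChartedSpace F N]
      (_ : LCCalculus.IsCrManifold ℝ r F N)
      (f : M → N) (_ : LCCalculus.IsCrMap ℝ r (E := E) (F := F) f)
      (_ : (LCCalculus.IsBanach ℝ E ∧ 2 ≤ r) ∨ FiniteDimensional ℝ E),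
      LCCalculus.IsCrImmersion ℝ r (E := E) (F := F) f ↔
        LCCalculus.IsNaiveImmersion ℝ r (E := E) (F := F) f) ∧
    -- the complex case, `r = ω`
    (∀ (E : Type*) [AddCommGroup E] [Module ℂ E] [TopologicalSpace E] [IsTopologicalAddGroup E]
      [ContinuousSMul ℂ E] [LocallyConvexSpace ℝ E] [T2Space E]
      (F : Type*) [AddCommGroup F] [Module ℂ F] [TopologicalSpace F] [IsTopologicalAddGroup F]
      [ContinuousSMul ℂ F] [LocallyConvexSpace ℝ F] [T2Space F]
      (M : Type*) [TopologicalSpace M] [T2Space M] [ChartedSpace E M]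
      (_ : LCCalculus.IsCrManifold ℂ ω E M)
      (N : Type*) [TopologicalSpace N] [T2Space N] [ChartedSpace F N]
      (_ : LCCalculus.IsCrManifold ℂ ω F N)
      (f : M → N) (_ : LCCalculus.IsCrMap ℂ ω (E := E) (F := F) f)
      (_ : LCCalculus.IsBanach ℂ E ∨ FiniteDimensional ℂ E),
      LCCalculus.IsCrImmersion ℂ ω (E := E) (F := F) f ↔
        LCCalculus.IsNaiveImmersion ℂ ω (E := E) (F := F) f) := by
  constructor
  · intro r hr E _ _ _ _ _ _ _ F _ _ _ _ _ _ _ M _ _ _ hM N _ _ _ hN f hf h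
    have := LCCalculus.polynormableSpace_of_locallyConvexSpace ℝ E
    have := LCCalculus.polynormableSpace_of_locallyConvexSpace ℝ F
    exact LCCalculus.isCrImmersion_iff_isNaiveImmersion hr hM hN hf h
  · intro E _ _ _ _ _ _ _ F _ _ _ _ _ _ _ M _ _ _ hM N _ _ _ hN f hf h
    have := LCCalculus.polynormableSpace_of_locallyConvexSpace ℂ E
    have := LCCalculus.polynormableSpace_of_locallyConvexSpace ℂ F
    exact LCCalculus.isCrImmersion_iff_isNaiveImmersion le_top hM hN hf
      (h.imp_left fun hB => ⟨hB, le_top⟩)
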